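/- Let $D\ge 2$, let $\eta=\mathrm{diag}(1,-1,\dots,-1)$ on $\mathbb R^D$ (indices $0,\dots,D-1$) and $x\cdot y=\eta_{\mu\nu}x^\mu y^\nu$. Let $p\in\mathbb R^D$ (in particular, any $p$ on a mass shell is allowed) and $k\in\mathbb R^D$ with $$k\cdot k=0,\qquad k^j=0\ (j=1,\dots,D-2),\qquad k\cdot p=-1 .$$ Let $\mathcal F=\mathcal F^{(\alpha)}_{\rm cov}$ be the (algebraic, complex) covariant Fock space: it is generated from the vacuum $\Omega$ by operators $\alpha^\mu_m$, $m\in\mathbb Z\setminus\{0\}$, $\mu=0,\dots,D-1$, with $[\alpha^\mu_m,\alpha^\nu_n]=-\eta^{\mu\nu}m\,\delta_{m+n,0}$, $\alpha^\mu_m\Omega=0$ for $m>0$ and $(\alpha^\mu_m)^\dagger=\alpha^\mu_{-m}$ for its (indefinite) Hermitian form; that is, $\mathcal F$ is the polynomial algebra in the $\alpha^\mu_{-m}$, $m>0$. Put $\alpha^\mu_0=p^\mu$ and, on $\mathcal F$, $$L_m=-\tfrac12\,\eta_{\mu\nu}\sum_{n\in\mathbb Z}{:}\alpha^\mu_{m-n}\alpha^\nu_n{:}-\delta_{m,0},\qquad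 K_m=k\cdot\alpha_m .$$ For $q\in\mathbb R^D$ put $U_0(q)=1$, $U_n(q)=\frac1n\sum_{l=1}^nU_{n-l}(q)\,(q\cdot\alpha_l)$ for $n>0$, $U_n(q)=0$ for $n<0$, and $$V_n(q)=\sum_{r\in\mathbb Z}U_{r-n}(-q)^\dagger U_r(q),\qquad V^\mu_n(q)=\sum_{r>0}\bigl(\alpha^\mu_{-r}V_{n+r}(q)+V_{n-r}(q)\alpha^\mu_r\bigr)+p^\mu V_n(q)$$ (all these sums are finite on each vector of $\mathcal F$). The DDF operators are $A^j_n=V^j_n(nk)$, $j=1,\dots,D-2$, and the DDF states are the linear combinations of the vectors $A^{j_1}_{m_1}\cdots A^{j_l}_{m_l}\Omega$ with $l\ge0$ and $m_1,\dots,m_l<0$. For finitely supported sequences $\lambda=(\lambda_1,\lambda_2,\dots)$ and $\mu=(\mu_1,\mu_2,\dots)$ of integers $\ge 0$ and a DDF state $f$ let $$\Psi_{\lambda,\mu,f}=L_{-1}^{\lambda_1}L_{-2}^{\lambda_2}\cdots K_{-1}^{\mu_1}K_{-2}^{\mu_2}\cdots f .$$ **Proposition.** The vectors $\Psi_{\lambda,\mu,f}$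 are linearly independent and generate $\mathcal F$. Precisely: 1. for every linearly independent family $(f_i)_{i\in I}$ of DDF states, the family $(\Psi_{\lambda,\mu,f_i})_{\lambda,\mu,i}$ is linearly independent; 2. the vectors $\Psi_{\lambda,\mu,f}$, with $\lambda,\mu$ as above and $f$ a DDF state, span $\mathcal F$; 3. the vectors $\prod_m L_{-m}^{\lambda_m}\prod_n K_{-n}^{\mu_n}\prod_{q,j}(A^j_{-q})^{\beta_{q,j}}\Omega$ (each product in increasing order of the index, lexicographic for $(q,j)$), where $\lambda,\mu$ and $\beta=(\beta_{q,j})_{q\ge1,\,1\le j\le D-2}$ run over all finitely supported families of integers $\ge0$, are linearly independent and span $\mathcal F$. -/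

import Mathlib

open scoped BigOperators ComplexConjugate

noncomputable section

namespace CovariantString

variable {d : ℕ}

/-! ### Minkowski space of dimension `D = d + 2`, indices `0, 1, …, D - 1 = d + 1` -/

/-- The diagonal entries of the Minkowski metric `η = diag (1, -1, …, -1)`. -/
def eta (μ : Fin (d + 2)) : ℝ := if μ = 0 then 1 else -1

/-- The Minkowski product `x · y = η_{μν} x^μ y^ν`. -/
def mdot (x y : Fin (d + 2) → ℝ) : ℝ := ∑ μ, eta μ * x μ * y μ

/-- The transversal index `j = 1, …, D - 2`, numbered from `0`. -/
def transv (j : Fin d) : Fin (d + 2) := j.succ.castSucc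

/-! ### The covariant Fock space -/

/-- The (algebraic) covariant Fock space in the holomorphic representation: polynomials in the
variables `X (μ, n)`, which stand for the creation operators `α^μ_{-(n+1)}`. -/
abbrev Fock (d : ℕ) : Type := MvPolynomial (Fin (d + 2) × ℕ) ℂ

/-- Operators on the Fock space. -/
abbrev Op (d : ℕ) : Type := Module.End ℂ (Fock d)

/-- The vacuum. -/
def vac : Fock d := 1

/-- The operators `α^μ_m` over the momentum `p`:
`α^μ_0 = p^μ`, `α^μ_{-(n+1)}` is multiplication by its variable, and
`α^μ_{n+1} = -η_{μμ} (n+1) ∂ / ∂X (μ, n)`.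
So `[α^μ_m, α^ν_n] = - η_{μν} m δ_{m+n}` and `α^μ_m Ω = 0` for `m > 0`. -/
def alpha (p : Fin (d + 2) → ℝ) (μ : Fin (d + 2)) : ℤ → Op d
  | .ofNat 0 => (p μ : ℂ) • (1 : Op d)
  | .ofNat (n + 1) =>
      ((-eta μ * ((n : ℝ) + 1) : ℝ) : ℂ) • (MvPolynomial.pderiv (R := ℂ) (μ, n)).toLinearMap
  | .negSucc n => LinearMap.mulLeft ℂ (MvPolynomial.X (μ, n))

/-- `k · α_m = η_{μν} k^μ α^ν_m`. -/
def kdot (p k : Fin (d + 2) → ℝ) (m : ℤ) : Op d :=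
  ∑ μ, ((eta μ * k μ : ℝ) : ℂ) • alpha p μ m

/-! ### The Hermitian form -/

/-- The value `∏ a_i! (-η_{μμ} (n+1))^{a_i}`, `i = (μ, n)`, of the Hermitian form on the
monomial `X^a`. -/
def formWeight (a : Fin (d + 2) × ℕ →₀ ℕ) : ℝ :=
  a.prod fun i e => (e.factorial : ℝ) * (-eta i.1 * ((i.2 : ℝ) + 1)) ^ e

/-- The Hermitian form (antilinear in the first argument): the monomials are orthogonal, and
`⟨Ω, Ω⟩ = 1`. -/
def form (φ ψ : Fock d) : ℂ :=
  ∑ a ∈ φ.support, conj (φ.coeff a) * (formWeight a : ℂ) * ψ.coeff a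

/-- `T` is the adjoint of `S` with respect to the Hermitian form. -/
def IsAdjoint (S T : Op d) : Prop := ∀ φ ψ, form (S φ) ψ = form φ (T ψ)

theorem form_eq_sum {φ : Fock d} (ψ : Fock d) {s : Finset (Fin (d + 2) × ℕ →₀ ℕ)}
    (h : φ.support ⊆ s) :
    form φ ψ = ∑ a ∈ s, conj (φ.coeff a) * (formWeight a : ℂ) * ψ.coeff a :=
  Finset.sum_subset h fun a _ ha => by simp [MvPolynomial.notMem_support_iff.1 ha]

theorem form_add_left (φ φ' ψ : Fock d) : form (φ + φ') ψ = form φ ψ + form φ' ψ := by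
  classical
  rw [form_eq_sum (s := φ.support ∪ φ'.support) ψ MvPolynomial.support_add,
    form_eq_sum ψ Finset.subset_union_left, form_eq_sum ψ Finset.subset_union_right,
    ← Finset.sum_add_distrib]
  exact Finset.sum_congr rfl fun a _ => by simp; ring

theorem form_add_right (φ ψ ψ' : Fock d) : form φ (ψ + ψ') = form φ ψ + form φ ψ' := by
  rw [form, form, form, ← Finset.sum_add_distrib]
  exact Finset.sum_congr rfl fun a _ => by simp; ring

theorem form_smul_right (c : ℂ) (φ ψ : Fock d) : form φ (c • ψ) = c * form φ ψ := by
  rw [form, form, Finset.mul_sum]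
  exact Finset.sum_congr rfl fun a _ => by simp; ring

theorem form_symm (φ ψ : Fock d) : conj (form φ ψ) = form ψ φ := by
  classical
  rw [form_eq_sum (s := φ.support ∪ ψ.support) ψ Finset.subset_union_left,
    form_eq_sum (s := φ.support ∪ ψ.support) φ Finset.subset_union_right, map_sum]
  exact Finset.sum_congr rfl fun a _ => by simp; ring

theorem form_smul_left (c : ℂ) (φ ψ : Fock d) : form (c • φ) ψ = conj c * form φ ψ := by
  rw [← form_symm, form_smul_right, map_mul, form_symm]

theorem formWeight_add_single (a : Fin (d + 2) × ℕ →₀ ℕ) (i : Fin (d + 2) × ℕ) :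
    formWeight (a + Finsupp.single i 1) =
      formWeight a * (((a i : ℝ) + 1) * (-eta i.1 * ((i.2 : ℝ) + 1))) := by
  have h0 : ∀ j : Fin (d + 2) × ℕ,
      ((Nat.factorial 0 : ℕ) : ℝ) * (-eta j.1 * ((j.2 : ℝ) + 1)) ^ 0 = 1 := by simp
  have he : (a + Finsupp.single i 1).erase i = a.erase i := by
    ext j
    by_cases h : j = i
    · simp [h]
    · simp [Finsupp.erase_ne h]
  rw [formWeight, formWeight, ← Finsupp.mul_prod_erase' _ i _ h0,
    ← Finsupp.mul_prod_erase' a i _ h0, he]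
  simp only [Finsupp.add_apply, Finsupp.single_eq_same, Nat.factorial_succ, pow_succ]
  push_cast
  ring

namespace IsAdjoint

theorem symm {S T : Op d} (h : IsAdjoint S T) : IsAdjoint T S := fun φ ψ => by
  rw [← form_symm, ← h, form_symm]

theorem one : IsAdjoint (1 : Op d) 1 := fun _ _ => rfl

theorem mul {S S' T T' : Op d} (h : IsAdjoint S T) (h' : IsAdjoint S' T') :
    IsAdjoint (S * S') (T' * T) := fun φ ψ => by
  simp only [Module.End.mul_apply, h _ _, h' _ _]

theorem smul {S T : Op d} {c : ℂ} (hc : conj c = c) (h : IsAdjoint S T) :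
    IsAdjoint (c • S) (c • T) := fun φ ψ => by
  simp only [LinearMap.smul_apply, form_smul_left, form_smul_right, hc, h _ _]

theorem add {S S' T T' : Op d} (h : IsAdjoint S T) (h' : IsAdjoint S' T') :
    IsAdjoint (S + S') (T + T') := fun φ ψ => by
  simp only [LinearMap.add_apply, form_add_left, form_add_right, h _ _, h' _ _]

theorem sum {ι : Type} (s : Finset ι) {S T : ι → Op d} (h : ∀ i, IsAdjoint (S i) (T i)) :
    IsAdjoint (∑ i ∈ s, S i) (∑ i ∈ s, T i) := by
  classical
  induction s using Finset.induction_on with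
  | empty => intro φ ψ; simp [form]
  | insert i s hi ih => rw [Finset.sum_insert hi, Finset.sum_insert hi]; exact (h i).add ih

end IsAdjoint

theorem alpha_negSucc_adjoint (p : Fin (d + 2) → ℝ) (μ : Fin (d + 2)) (n : ℕ) :
    IsAdjoint (alpha p μ (.negSucc n)) (alpha p μ (.ofNat (n + 1))) := by
  intro φ ψ
  induction φ using MvPolynomial.induction_on' with
  | add f g hf hg => rw [map_add, form_add_left, form_add_left, hf, hg]
  | monomial a c =>
    have h1 : alpha p μ (.negSucc n) (MvPolynomial.monomial a c) =
        MvPolynomial.monomial (a + Finsupp.single (μ, n) 1) c := by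
      rw [alpha, LinearMap.mulLeft_apply, mul_comm, MvPolynomial.X, MvPolynomial.monomial_mul,
        mul_one]
    rw [h1, form_eq_sum ψ MvPolynomial.support_monomial_subset,
      form_eq_sum _ MvPolynomial.support_monomial_subset, Finset.sum_singleton,
      Finset.sum_singleton, formWeight_add_single, alpha, LinearMap.smul_apply,
      MvPolynomial.coeff_smul]
    rw [show (MvPolynomial.pderiv (R := ℂ) (μ, n)).toLinearMap ψ =
      MvPolynomial.pderiv (μ, n) ψ from rfl, MvPolynomial.coeff_pderiv]
    simp
    ring

theorem alpha_adjoint (p : Fin (d + 2) → ℝ) (μ : Fin (d + 2)) (m : ℤ) :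
    IsAdjoint (alpha p μ m) (alpha p μ (-m)) := by
  match m with
  | .ofNat 0 => exact IsAdjoint.one.smul (Complex.conj_ofReal _)
  | .ofNat (n + 1) => exact (alpha_negSucc_adjoint p μ n).symm
  | .negSucc n => exact alpha_negSucc_adjoint p μ n

theorem kdot_adjoint (p k : Fin (d + 2) → ℝ) (m : ℤ) : IsAdjoint (kdot p k m) (kdot p k (-m)) :=
  IsAdjoint.sum _ fun μ => (alpha_adjoint p μ m).smul (Complex.conj_ofReal _)

/-! ### Pointwise finite sums of operators -/

/-- The sum of a family of operators of which only finitely many are nonzero on any given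
vector. -/
def locSum {ι : Type} (T : ι → Op d) (h : ∀ v, {i | T i v ≠ 0}.Finite) : Op d where
  toFun v := ∑ᶠ i, T i v
  map_add' v w := by
    simp only [map_add]
    exact finsum_add_distrib (h v) (h w)
  map_smul' c v := by
    simp only [map_smul, RingHom.id_apply]
    exact (smul_finsum c _).symm

/-- The level of a monomial: the variable `X (μ, n)` counts `n + 1`. -/
def level (a : Fin (d + 2) × ℕ →₀ ℕ) : ℕ := Finsupp.weight (fun i : Fin (d + 2) × ℕ => i.2 + 1) a

/-- The span of the monomials of level at most `N`. -/
def lvl (d : ℕ) (N : ℤ) : Submodule ℂ (Fock d) :=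
  Submodule.span ℂ ((fun a => MvPolynomial.monomial a (1 : ℂ)) '' {a | (level a : ℤ) ≤ N})

/-- `T` lowers the level by (at least) `n`. -/
def Lowers (T : Op d) (n : ℤ) : Prop := ∀ N : ℤ, ∀ v ∈ lvl d N, T v ∈ lvl d (N - n)

theorem lvl_mono {M N : ℤ} (h : M ≤ N) : lvl d M ≤ lvl d N :=
  Submodule.span_mono (Set.image_mono fun _ ha => le_trans ha h)

theorem lvl_neg {N : ℤ} (h : N < 0) : lvl d N = ⊥ := by
  have : {a : Fin (d + 2) × ℕ →₀ ℕ | (level a : ℤ) ≤ N} = ∅ := by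
    ext a
    simp only [Set.mem_ofPred_eq, Set.mem_empty_iff_false, iff_false]
    omega
  simp [lvl, this]

theorem exists_lvl (v : Fock d) : ∃ N : ℤ, v ∈ lvl d N := by
  induction v using MvPolynomial.induction_on' with
  | monomial a c =>
    refine ⟨level a, ?_⟩
    have : MvPolynomial.monomial a c = c • MvPolynomial.monomial (R := ℂ) a 1 := by
      simp [MvPolynomial.smul_monomial]
    rw [this]
    exact Submodule.smul_mem _ _ (Submodule.subset_span ⟨a, by simp, rfl⟩)
  | add f g hf hg =>
    obtain ⟨M, hM⟩ := hf
    obtain ⟨N, hN⟩ := hg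
    exact ⟨max M N, Submodule.add_mem _ (lvl_mono (le_max_left _ _) hM)
      (lvl_mono (le_max_right _ _) hN)⟩

namespace Lowers

theorem of_monomial {T : Op d} {n : ℤ}
    (h : ∀ a, T (MvPolynomial.monomial a 1) ∈ lvl d (level a - n)) : Lowers T n := by
  intro N v hv
  have : lvl d N ≤ (lvl d (N - n)).comap T := by
    refine Submodule.span_le.2 ?_
    rintro _ ⟨a, ha, rfl⟩
    exact lvl_mono (sub_le_sub_right ha n) (h a)
  exact this hv

theorem zero (n : ℤ) : Lowers (0 : Op d) n := fun N v _ => by simp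

theorem one : Lowers (1 : Op d) 0 := fun N v hv => by simpa using hv

theorem smul {T : Op d} {n : ℤ} (c : ℂ) (h : Lowers T n) : Lowers (c • T) n :=
  fun N v hv => Submodule.smul_mem _ c (h N v hv)

theorem add {S T : Op d} {n : ℤ} (hS : Lowers S n) (hT : Lowers T n) : Lowers (S + T) n :=
  fun N v hv => Submodule.add_mem _ (hS N v hv) (hT N v hv)

theorem sum {ι : Type} (s : Finset ι) {T : ι → Op d} {n : ℤ} (h : ∀ i, Lowers (T i) n) :
    Lowers (∑ i ∈ s, T i) n := fun N v hv => by
  rw [LinearMap.sum_apply]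
  exact Submodule.sum_mem _ fun i _ => h i N v hv

theorem mul {S T : Op d} {m n : ℤ} (hS : Lowers S m) (hT : Lowers T n) :
    Lowers (S * T) (m + n) := fun N v hv => by
  have := hS _ _ (hT N v hv)
  rwa [show N - n - m = N - (m + n) by ring] at this

theorem cast {T : Op d} {m n : ℤ} (h : Lowers T m) (e : m = n) : Lowers T n := e ▸ h

theorem apply_eq_zero {T : Op d} {n N : ℤ} (h : Lowers T n) {v : Fock d} (hv : v ∈ lvl d N)
    (hn : N < n) : T v = 0 := by
  have := h N v hv
  rwa [lvl_neg (by omega), Submodule.mem_bot] at this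

theorem locSum {ι : Type} {T : ι → Op d} {n : ℤ} (h : ∀ v, {i | T i v ≠ 0}.Finite)
    (hT : ∀ i, Lowers (T i) n) : Lowers (locSum T h) n := fun N v hv =>
  finsum_induction (· ∈ lvl d (N - n)) (Submodule.zero_mem _)
    (fun _ _ => Submodule.add_mem _) fun i => hT i N v hv

end Lowers

theorem alpha_lowers (p : Fin (d + 2) → ℝ) (μ : Fin (d + 2)) (m : ℤ) :
    Lowers (alpha p μ m) m := by
  match m with
  | .ofNat 0 => exact Lowers.smul _ Lowers.one
  | .ofNat (n + 1) =>
    refine Lowers.smul _ (Lowers.of_monomial fun a => ?_)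
    rw [show (MvPolynomial.pderiv (R := ℂ) (μ, n)).toLinearMap (MvPolynomial.monomial a 1) = _ from
      MvPolynomial.pderiv_monomial]
    by_cases h : a (μ, n) = 0
    · simp [h]
    · have h1 : Finsupp.single (μ, n) 1 ≤ a := by
        rw [Finsupp.single_le_iff]; omega
      have h2 : level (a - Finsupp.single (μ, n) 1) + (n + 1) = level a := by
        conv_rhs => rw [← tsub_add_cancel_of_le h1]
        simp [level, map_add, Finsupp.weight_single]
      have h3 : MvPolynomial.monomial (a - Finsupp.single (μ, n) 1) (1 * ((a (μ, n) : ℕ) : ℂ)) =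
          ((a (μ, n) : ℕ) : ℂ) •
            MvPolynomial.monomial (R := ℂ) (a - Finsupp.single (μ, n) 1) 1 := by
        simp [MvPolynomial.smul_monomial]
      rw [h3]
      refine Submodule.smul_mem _ _ (Submodule.subset_span ⟨_, ?_, rfl⟩)
      simp only [Set.mem_ofPred_eq, Int.ofNat_eq_natCast]
      omega
  | .negSucc n =>
    refine Lowers.of_monomial fun a => ?_
    rw [alpha, LinearMap.mulLeft_apply, MvPolynomial.X, MvPolynomial.monomial_mul, one_mul]
    refine Submodule.subset_span ⟨_, ?_, rfl⟩
    simp only [Set.mem_ofPred_eq, level, map_add, Finsupp.weight_single]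
    simp only [smul_eq_mul, one_mul, Int.negSucc_eq]
    push_cast
    omega

theorem kdot_lowers (p k : Fin (d + 2) → ℝ) (m : ℤ) : Lowers (kdot p k m) m :=
  Lowers.sum _ fun μ => Lowers.smul _ (alpha_lowers p μ m)

/-! ### The Virasoro operators -/

/-- The normally ordered product `:α^μ_a α^μ_b:`. -/
def wick (p : Fin (d + 2) → ℝ) (μ : Fin (d + 2)) (a b : ℤ) : Op d :=
  if a ≤ b then alpha p μ a * alpha p μ b else alpha p μ b * alpha p μ a

theorem virasoro_finite (p : Fin (d + 2) → ℝ) (m : ℤ) (v : Fock d) :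
    {n : ℤ | (∑ μ, (eta μ : ℂ) • wick p μ (m - n) n) v ≠ 0}.Finite := by
  obtain ⟨N, hN⟩ := exists_lvl v
  refine (Set.finite_Icc (m - N) N).subset fun n hn => ?_
  by_contra hcon
  refine hn ?_
  rw [LinearMap.sum_apply]
  refine Finset.sum_eq_zero fun μ _ => ?_
  rw [LinearMap.smul_apply, wick]
  have hcon' : n < m - N ∨ N < n := by
    simp only [Set.mem_Icc, not_and_or, not_le] at hcon
    exact hcon
  split_ifs with h
  · rw [Module.End.mul_apply, (alpha_lowers p μ n).apply_eq_zero hN (by omega)]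
    simp
  · rw [Module.End.mul_apply, (alpha_lowers p μ (m - n)).apply_eq_zero hN (by omega)]
    simp

/-- The covariant Virasoro operators
`L_m = - (1/2) η_{μν} ∑_{n ∈ ℤ} :α^μ_{m-n} α^ν_n: - a δ_m` with `α^μ_0 = p^μ`. -/
def virasoro (p : Fin (d + 2) → ℝ) (a : ℝ) (m : ℤ) : Op d :=
  (-(1 / 2) : ℂ) •
      locSum (fun n : ℤ => ∑ μ, (eta μ : ℂ) • wick p μ (m - n) n) (virasoro_finite p m)
    - (if m = 0 then (a : ℂ) else 0) • (1 : Op d)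

/-! ### The operators `U_n (k)` and `V_n (k)` -/

/-- `U_0 = 1`, `U_n = (1/n) ∑_{l=1}^n U_{n-l} (k · α_l)`. -/
def U (p k : Fin (d + 2) → ℝ) : ℕ → Op d
  | 0 => 1
  | n + 1 => (1 / ((n : ℂ) + 1)) • ∑ l : Fin (n + 1), U p k (n - l) * kdot p k ((l : ℤ) + 1)

/-- The adjoint `U_n (k)^†` with respect to the Hermitian form (see `U_adjoint`). -/
def Udag (p k : Fin (d + 2) → ℝ) : ℕ → Op d
  | 0 => 1
  | n + 1 => (1 / ((n : ℂ) + 1)) • ∑ l : Fin (n + 1), kdot p k (-((l : ℤ) + 1)) * Udag p k (n - l)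

theorem U_adjoint (p k : Fin (d + 2) → ℝ) (n : ℕ) : IsAdjoint (U p k n) (Udag p k n) := by
  induction n using Nat.strong_induction_on with
  | _ n ih =>
    cases n with
    | zero => rw [U, Udag]; exact IsAdjoint.one
    | succ n =>
      rw [U, Udag]
      refine IsAdjoint.smul (by simp) (IsAdjoint.sum _ fun l => ?_)
      exact (ih (n - l) (by omega)).mul (kdot_adjoint p k ((l : ℤ) + 1))

/-- `U_n (k)` for `n ∈ ℤ`, zero for `n < 0`. -/
def UZ (p k : Fin (d + 2) → ℝ) (n : ℤ) : Op d := if n < 0 then 0 else U p k n.toNat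

/-- `U_n (k)^†` for `n ∈ ℤ`, zero for `n < 0`. -/
def UdagZ (p k : Fin (d + 2) → ℝ) (n : ℤ) : Op d := if n < 0 then 0 else Udag p k n.toNat

theorem U_lowers (p k : Fin (d + 2) → ℝ) (n : ℕ) : Lowers (U p k n) n := by
  induction n using Nat.strong_induction_on with
  | _ n ih =>
    cases n with
    | zero => rw [U]; exact Lowers.one
    | succ n =>
      rw [U]
      refine Lowers.smul _ (Lowers.sum _ fun l => ?_)
      refine ((ih (n - l) (by omega)).mul (kdot_lowers p k _)).cast ?_
      have := l.2
      omega

theorem Udag_lowers (p k : Fin (d + 2) → ℝ) (n : ℕ) : Lowers (Udag p k n) (-n) := by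
  induction n using Nat.strong_induction_on with
  | _ n ih =>
    cases n with
    | zero => rw [Udag]; exact Lowers.one
    | succ n =>
      rw [Udag]
      refine Lowers.smul _ (Lowers.sum _ fun l => ?_)
      refine ((kdot_lowers p k _).mul (ih (n - l) (by omega))).cast ?_
      have := l.2
      omega

theorem UZ_lowers (p k : Fin (d + 2) → ℝ) (n : ℤ) : Lowers (UZ p k n) n := by
  rw [UZ]
  split_ifs with h
  · exact Lowers.zero n
  · exact (U_lowers p k n.toNat).cast (by omega)

theorem UdagZ_lowers (p k : Fin (d + 2) → ℝ) (n : ℤ) : Lowers (UdagZ p k n) (-n) := by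
  rw [UdagZ]
  split_ifs with h
  · exact Lowers.zero _
  · exact (Udag_lowers p k n.toNat).cast (by omega)

theorem V_finite (p k : Fin (d + 2) → ℝ) (n : ℤ) (v : Fock d) :
    {q : ℤ | (UdagZ p (-k) (q - n) * UZ p k q) v ≠ 0}.Finite := by
  obtain ⟨N, hN⟩ := exists_lvl v
  refine (Set.finite_Icc n N).subset fun q hq => ?_
  by_contra hcon
  refine hq ?_
  have hcon' : q < n ∨ N < q := by
    simp only [Set.mem_Icc, not_and_or, not_le] at hcon
    exact hcon
  rcases hcon' with h | h
  · rw [UdagZ, if_pos (by omega)]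
    simp
  · rw [Module.End.mul_apply, (UZ_lowers p k q).apply_eq_zero hN h]
    simp

/-- `V_n (k) = ∑_{q ∈ ℤ} U_{q-n} (-k)^† U_q (k)`. -/
def V (p k : Fin (d + 2) → ℝ) (n : ℤ) : Op d :=
  locSum (fun q : ℤ => UdagZ p (-k) (q - n) * UZ p k q) (V_finite p k n)

theorem V_lowers (p k : Fin (d + 2) → ℝ) (n : ℤ) : Lowers (V p k n) n :=
  Lowers.locSum _ fun q => ((UdagZ_lowers p (-k) (q - n)).mul (UZ_lowers p k q)).cast (by ring)

/-! ### The DDF operators -/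

theorem Vbar_finite (p k : Fin (d + 2) → ℝ) (μ : Fin (d + 2)) (n : ℤ) (v : Fock d) :
    {q : ℕ | (alpha p μ (-((q : ℤ) + 1)) * V p k (n + ((q : ℤ) + 1)) +
      V p k (n - ((q : ℤ) + 1)) * alpha p μ ((q : ℤ) + 1)) v ≠ 0}.Finite := by
  obtain ⟨N, hN⟩ := exists_lvl v
  refine (Set.finite_Iic (N.toNat + n.natAbs)).subset fun q hq => ?_
  by_contra hcon
  refine hq ?_
  simp only [Set.mem_Iic, not_le] at hcon
  rw [LinearMap.add_apply, Module.End.mul_apply, Module.End.mul_apply,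
    (V_lowers p k (n + ((q : ℤ) + 1))).apply_eq_zero hN (by omega),
    (alpha_lowers p μ ((q : ℤ) + 1)).apply_eq_zero hN (by omega)]
  simp

/-- `V̄^μ_n (k) = ∑_{q > 0} (α^μ_{-q} V_{n+q} (k) + V_{n-q} (k) α^μ_q)`; the summation index
below is `q - 1`. -/
def Vbar (p k : Fin (d + 2) → ℝ) (μ : Fin (d + 2)) (n : ℤ) : Op d :=
  locSum (fun q : ℕ => alpha p μ (-((q : ℤ) + 1)) * V p k (n + ((q : ℤ) + 1)) +
      V p k (n - ((q : ℤ) + 1)) * alpha p μ ((q : ℤ) + 1)) (Vbar_finite p k μ n)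

/-- `V^μ_n (k) = V̄^μ_n (k) + p^μ V_n (k)`. -/
def Vvec (p k : Fin (d + 2) → ℝ) (μ : Fin (d + 2)) (n : ℤ) : Op d :=
  Vbar p k μ n + (p μ : ℂ) • V p k n

/-- The DDF operators `A^j_n = V^j_n (n k)`, `j` a transversal index. -/
def ddf (p k : Fin (d + 2) → ℝ) (j : Fin d) (n : ℤ) : Op d :=
  Vvec p ((n : ℝ) • k) (transv j) n

/-- The DDF states: linear combinations of the vectors
`A^{j_1}_{m_1} ⋯ A^{j_l}_{m_l} Ω` with `m_1, …, m_l < 0`. -/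
def ddfStates (p k : Fin (d + 2) → ℝ) : Submodule ℂ (Fock d) :=
  Submodule.span ℂ
    {v | ∃ w : List (Fin d × ℤ), (∀ x ∈ w, x.2 < 0) ∧
      v = (w.map fun x => ddf p k x.1 x.2).prod vac}

/-! ### Ordered monomials -/

/-- The product `T_{i_1}^{e_{i_1}} T_{i_2}^{e_{i_2}} ⋯` over the support `i_1 < i_2 < ⋯` of `e`. -/
def ordMonomial {ι : Type} [LinearOrder ι] (T : ι → Op d) (e : ι →₀ ℕ) : Op d :=
  (e.support.sort.map fun i => T i ^ e i).prod

/-- `L_{-1}^{λ_1} L_{-2}^{λ_2} ⋯ K_{-1}^{μ_1} K_{-2}^{μ_2} ⋯`, where `L_m` is taken with `a = 1`,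
`K_m = k · α_m`, and the exponents `λ_{n+1}`, `μ_{n+1}` are `lam n`, `mu n`. -/
def lkMonomial (p k : Fin (d + 2) → ℝ) (lam mu : ℕ →₀ ℕ) : Op d :=
  ordMonomial (fun n : ℕ => virasoro p 1 (-((n : ℤ) + 1))) lam *
    ordMonomial (fun n : ℕ => kdot p k (-((n : ℤ) + 1))) mu

/-- `∏ (A^j_{-q})^{β_{q,j}} Ω`, where `β_{n+1,j}` is `β (n, j)`. -/
def ddfMonomial (p k : Fin (d + 2) → ℝ) (β : ℕ ×ₗ Fin d →₀ ℕ) : Fock d :=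
  ordMonomial (fun x : ℕ ×ₗ Fin d => ddf p k (ofLex x).2 (-(((ofLex x).1 : ℤ) + 1))) β vac

end CovariantString

end

noncomputable section

namespace CovariantString

variable {d : ℕ}

/-! ### Light-cone coordinates -/

/-! Since k·p = -1, the lightlike vector k is nonzero and has a null partner l in the plane of the
first and last coordinates, with k·l = 1. The Fock space is then the polynomial algebra in the
light-cone variables l·α_{-n}, k·α_{-n} and α^j_{-n}, n > 0. Their monomials are ordered
lexicographically by the pair (`ydeg`, `rdeg`): the degree in the l·α_{-n}, then the level
diminished by the degree in the k·α_{-n}.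

Up to terms strictly lower in this order, L_{-n} is multiplication by l·α_{-n} and A^j_{-n} is
multiplication by α^j_{-n}, while K_{-n} is exactly multiplication by k·α_{-n}. In L_{-n} the
leading term comes from the zero modes through k·α_0 = k·p = -1. Every other term is transversal, so
lacks a factor l·α_{-r}, or contains k·α_r with r ≠ 0: for r > 0 this differentiates an l-variable
and lowers `ydeg`, for r < 0 it creates a k-variable, which `rdeg` counts one below its level. The
same dichotomy disposes of the exponentials in A^j_{-n}. Hence the ordered monomials of statement 3
are unitriangular over the basis of light-cone monomials (`shifts_virasoro_sub`, `shifts_ddf_sub`,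
`leads_psi`, `psi_basis`).

Statements 1 and 2 concern arbitrary DDF states, so unordered products of DDF operators must reduce
to ordered ones. It suffices that creating DDF operators commute on the vectors killed by all k·α_m,
m > 0, a space that contains the vacuum and is stable under these operators. There A^j_{-n} = ∑_r
U_{r+n}(nk)^† α^j_r, and the single contraction in a commutator vanishes by a generating-function
identity (`ddf_comm`, `ddfStates_le_span`). -/

theorem sum_split {M : Type*} [AddCommMonoid M] (f : Fin (d + 2) → M) :
    ∑ μ, f μ = f 0 + ∑ j : Fin d, f (transv j) + f (Fin.last (d + 1)) := by
  rw [Fin.sum_univ_castSucc, Fin.sum_univ_succ]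
  rfl

theorem transv_ne_zero (j : Fin d) : transv j ≠ 0 := by
  simp [transv, Fin.ext_iff]

theorem transv_ne_last (j : Fin d) : transv j ≠ Fin.last (d + 1) :=
  (Fin.castSucc_lt_last _).ne

theorem transv_injective : Function.Injective (transv (d := d)) := fun i j h => by
  simpa [transv] using h

theorem index_cases {P : Fin (d + 2) → Prop} (zero : P 0) (tr : ∀ j, P (transv j))
    (last : P (Fin.last (d + 1))) (μ : Fin (d + 2)) : P μ := by
  refine Fin.lastCases last (fun i => ?_) μ
  exact Fin.cases zero tr i

@[simp] theorem eta_zero : eta (0 : Fin (d + 2)) = 1 := by simp [eta]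

@[simp] theorem eta_transv (j : Fin d) : eta (transv j) = -1 := by
  simp [eta, transv_ne_zero]

@[simp] theorem eta_last : eta (Fin.last (d + 1)) = -1 := by
  simp [eta, Fin.ext_iff]

/-- `k` and `l` are lightlike vectors in the plane spanned by the first and the last coordinate,
with `k · l = 1`. -/
structure IsNullPair (k l : Fin (d + 2) → ℝ) : Prop where
  zero_mul_zero : k 0 * l 0 = 1 / 2
  last_mul_last : k (Fin.last (d + 1)) * l (Fin.last (d + 1)) = -(1 / 2)
  cross : k 0 * l (Fin.last (d + 1)) + k (Fin.last (d + 1)) * l 0 = 0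
  left_transv : ∀ j, k (transv j) = 0
  right_transv : ∀ j, l (transv j) = 0

theorem mdot_eq (x y : Fin (d + 2) → ℝ) :
    mdot x y = x 0 * y 0 - ∑ j, x (transv j) * y (transv j)
      - x (Fin.last (d + 1)) * y (Fin.last (d + 1)) := by
  rw [mdot, sum_split]
  simp
  ring

/-- Without transversal components, k·k = 0 says that the first and last components have equal
squares, so k ≠ 0 makes both nonzero. The witness is the opposite null direction, scaled to k·l = 1.
-/
theorem exists_isNullPair {k : Fin (d + 2) → ℝ} (hk : mdot k k = 0)
    (hkt : ∀ j : Fin d, k (transv j) = 0) (h0 : k ≠ 0) : ∃ l, IsNullPair k l := by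
  rw [mdot_eq] at hk
  simp only [hkt, mul_zero, Finset.sum_const_zero, sub_zero] at hk
  have hz : k 0 ≠ 0 := fun h => h0 <| by
    ext μ
    refine index_cases (P := fun μ => k μ = 0) h hkt ?_ μ
    simpa [h] using hk
  have hl : k (Fin.last (d + 1)) ≠ 0 := fun h => by simp [h, hz] at hk
  have hzl : (0 : Fin (d + 2)) ≠ Fin.last (d + 1) := by simp [Fin.ext_iff]
  refine ⟨fun μ => if μ = 0 then 1 / (2 * k 0) else
    if μ = Fin.last (d + 1) then -(1 / (2 * k (Fin.last (d + 1)))) else 0, ?_, ?_, ?_, hkt, ?_⟩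
  · simp; field_simp
  · simp [hzl.symm]; field_simp
  · simp [hzl.symm]; field_simp; linear_combination -hk
  · intro j; simp [transv_ne_zero, transv_ne_last]

namespace IsNullPair

variable {k l : Fin (d + 2) → ℝ}

theorem symm (h : IsNullPair k l) : IsNullPair l k where
  zero_mul_zero := by rw [mul_comm, h.zero_mul_zero]
  last_mul_last := by rw [mul_comm, h.last_mul_last]
  cross := by linear_combination h.cross
  left_transv := h.right_transv
  right_transv := h.left_transv

theorem left_null (h : IsNullPair k l) : mdot k k = 0 := by
  rw [mdot_eq]
  simp only [h.left_transv, mul_zero, Finset.sum_const_zero]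
  linear_combination -2 * k 0 * k (Fin.last (d + 1)) * h.cross
    + 2 * k (Fin.last (d + 1)) ^ 2 * h.zero_mul_zero + 2 * k 0 ^ 2 * h.last_mul_last

theorem mdot_eq_one (h : IsNullPair k l) : mdot k l = 1 := by
  rw [mdot_eq]
  simp only [h.left_transv, zero_mul, Finset.sum_const_zero]
  linear_combination h.zero_mul_zero - h.last_mul_last

end IsNullPair

/-- The light-cone variables: `inl n` for `l · α_{-(n+1)}`, `inr (inl n)` for `k · α_{-(n+1)}` and
`inr (inr (n, j))` for `α^j_{-(n+1)}`. -/
abbrev LCIndex (d : ℕ) : Type := ℕ ⊕ ℕ ⊕ (ℕ ×ₗ Fin d)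

/-- The linear form `u · α_{-(n+1)}` in the variables. -/
def lin (u : Fin (d + 2) → ℝ) (n : ℕ) : Fock d :=
  ∑ μ, ((eta μ * u μ : ℝ) : ℂ) • MvPolynomial.X (μ, n)

/-- The light-cone variables as elements of the Fock space. -/
def lcVar (k l : Fin (d + 2) → ℝ) : LCIndex d → Fock d
  | .inl n => lin l n
  | .inr (.inl n) => lin k n
  | .inr (.inr x) => MvPolynomial.X (transv (ofLex x).2, (ofLex x).1)

/-- The original variables in terms of the light-cone variables. -/
def lcBack (k l : Fin (d + 2) → ℝ) (x : Fin (d + 2) × ℕ) : MvPolynomial (LCIndex d) ℂ :=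
  (k x.1 : ℂ) • MvPolynomial.X (.inl x.2) + (l x.1 : ℂ) • MvPolynomial.X (.inr (.inl x.2)) +
    ∑ j : Fin d, if x.1 = transv j then MvPolynomial.X (.inr (.inr (toLex (x.2, j)))) else 0

theorem lin_eq {u : Fin (d + 2) → ℝ} (hu : ∀ j, u (transv j) = 0) (n : ℕ) :
    lin u n = (u 0 : ℂ) • MvPolynomial.X (0, n)
      - (u (Fin.last (d + 1)) : ℂ) • MvPolynomial.X (Fin.last (d + 1), n) := by
  rw [lin, sum_split]
  simp [hu, sub_eq_add_neg]

/-- The change to light-cone variables. -/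
def lcEquiv {k l : Fin (d + 2) → ℝ} (h : IsNullPair k l) :
    MvPolynomial (LCIndex d) ℂ ≃ₐ[ℂ] Fock d :=
  AlgEquiv.ofAlgHom (MvPolynomial.aeval (lcVar k l)) (MvPolynomial.aeval (lcBack k l))
    (by
      have h1 : (k 0 : ℂ) * l 0 = 1 / 2 := by
        rw [← Complex.ofReal_mul, h.zero_mul_zero]; norm_num
      have h2 : (k (Fin.last (d + 1)) : ℂ) * l (Fin.last (d + 1)) = -(1 / 2) := by
        rw [← Complex.ofReal_mul, h.last_mul_last]; norm_num
      have h3 : (k 0 : ℂ) * l (Fin.last (d + 1)) + k (Fin.last (d + 1)) * l 0 = 0 := by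
        exact_mod_cast congrArg Complex.ofReal h.cross
      -- Completeness of the null pair: α^μ = k^μ (l·α) + l^μ (k·α) on the two longitudinal indices.
      refine MvPolynomial.algHom_ext fun ⟨μ, n⟩ => ?_
      simp only [AlgHom.comp_apply, MvPolynomial.aeval_X, AlgHom.id_apply, lcBack, map_add, map_smul,
        map_sum, lcVar, lin_eq h.left_transv, lin_eq h.right_transv]
      induction μ using index_cases with
      | zero =>
        simp only [(transv_ne_zero _).symm, if_false, map_zero, Finset.sum_const_zero]
        linear_combination (norm := module) (2 * h1) • (MvPolynomial.X (0, n) : Fock d) -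
          h3 • (MvPolynomial.X (Fin.last (d + 1), n) : Fock d)
      | tr i =>
        rw [Finset.sum_eq_single i]
        · simp [h.left_transv, h.right_transv, lcVar]
        · intro j _ hj
          rw [if_neg fun e => hj (transv_injective e).symm, map_zero]
        · simp
      | last =>
        simp only [(transv_ne_last _).symm, if_false, map_zero, Finset.sum_const_zero]
        linear_combination (norm := module) h3 • (MvPolynomial.X (0, n) : Fock d) -
          (2 * h2) • (MvPolynomial.X (Fin.last (d + 1), n) : Fock d))
    (by
      have h1 : (k 0 : ℂ) * l 0 = 1 / 2 := by
        rw [← Complex.ofReal_mul, h.zero_mul_zero]; norm_num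
      have h2 : (k (Fin.last (d + 1)) : ℂ) * l (Fin.last (d + 1)) = -(1 / 2) := by
        rw [← Complex.ofReal_mul, h.last_mul_last]; norm_num
      have h4 : (k 0 : ℂ) * k 0 - k (Fin.last (d + 1)) * k (Fin.last (d + 1)) = 0 := by
        have := h.left_null
        simp only [mdot_eq, h.left_transv, mul_zero, Finset.sum_const_zero, sub_zero] at this
        exact_mod_cast congrArg Complex.ofReal this
      have h5 : (l 0 : ℂ) * l 0 - l (Fin.last (d + 1)) * l (Fin.last (d + 1)) = 0 := by
        have := h.symm.left_null
        simp only [mdot_eq, h.right_transv, mul_zero, Finset.sum_const_zero, sub_zero] at this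
        exact_mod_cast congrArg Complex.ofReal this
      -- The converse composition uses only k·k = l·l = 0 (`h4`, `h5`) and k·l = 1 (`h1 - h2`).
      refine MvPolynomial.algHom_ext fun x => ?_
      rw [AlgHom.comp_apply, MvPolynomial.aeval_X, AlgHom.id_apply]
      rcases x with n | n | x
      · simp only [lcVar, lin_eq h.right_transv, map_sub, map_smul, MvPolynomial.aeval_X, lcBack,
          (transv_ne_last _).symm, (transv_ne_zero _).symm, if_false, Finset.sum_const_zero]
        linear_combination (norm := module)
          (h1 - h2) • (MvPolynomial.X (.inl n) : MvPolynomial (LCIndex d) ℂ)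
          + h5 • (MvPolynomial.X (.inr (.inl n)) : MvPolynomial (LCIndex d) ℂ)
      · simp only [lcVar, lin_eq h.left_transv, map_sub, map_smul, MvPolynomial.aeval_X, lcBack,
          (transv_ne_last _).symm, (transv_ne_zero _).symm, if_false, Finset.sum_const_zero]
        linear_combination (norm := module)
          h4 • (MvPolynomial.X (.inl n) : MvPolynomial (LCIndex d) ℂ)
          + (h1 - h2) • (MvPolynomial.X (.inr (.inl n)) : MvPolynomial (LCIndex d) ℂ)
      · simp only [lcVar, MvPolynomial.aeval_X, lcBack, h.left_transv, h.right_transv]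
        rw [Finset.sum_eq_single (ofLex x).2]
        · simp
        · intro j _ hj
          rw [if_neg fun e => hj (transv_injective e).symm]
        · simp)

theorem lcEquiv_X {k l : Fin (d + 2) → ℝ} (h : IsNullPair k l) (i : LCIndex d) :
    lcEquiv h (MvPolynomial.X i) = lcVar k l i :=
  MvPolynomial.aeval_X _ _

/-! ### Creation and annihilation operators -/

theorem alpha_zero (p : Fin (d + 2) → ℝ) (μ : Fin (d + 2)) :
    alpha p μ 0 = (p μ : ℂ) • (1 : Op d) := rfl

theorem kdot_zero (p u : Fin (d + 2) → ℝ) : kdot p u 0 = (mdot u p : ℂ) • (1 : Op d) := by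
  simp only [kdot, alpha_zero, smul_smul, ← Finset.sum_smul, mdot]
  push_cast
  rfl

theorem alpha_neg (p : Fin (d + 2) → ℝ) (μ : Fin (d + 2)) (n : ℕ) :
    alpha p μ (-((n : ℤ) + 1)) = LinearMap.mulLeft ℂ (MvPolynomial.X (μ, n)) := by
  rw [← Int.negSucc_eq]
  rfl

theorem kdot_neg (p u : Fin (d + 2) → ℝ) (n : ℕ) :
    kdot p u (-((n : ℤ) + 1)) = LinearMap.mulLeft ℂ (lin u n) := by
  refine LinearMap.ext fun v => ?_
  simp only [kdot, alpha_neg, lin, LinearMap.sum_apply, LinearMap.smul_apply,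
    LinearMap.mulLeft_apply, Finset.sum_mul, smul_mul_assoc]

theorem alpha_pos (p : Fin (d + 2) → ℝ) (μ : Fin (d + 2)) (n : ℕ) :
    alpha p μ ((n : ℤ) + 1) = ((-eta μ * ((n : ℝ) + 1) : ℝ) : ℂ) •
      (MvPolynomial.pderiv (R := ℂ) (μ, n)).toLinearMap := rfl

/-- The derivation `u · α_{n+1}`. -/
def annih (u : Fin (d + 2) → ℝ) (n : ℕ) : Derivation ℂ (Fock d) (Fock d) :=
  ∑ μ, ((-(u μ * ((n : ℝ) + 1)) : ℝ) : ℂ) • MvPolynomial.pderiv (R := ℂ) (μ, n)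

theorem eta_mul_self (μ : Fin (d + 2)) : eta μ * eta μ = 1 := by
  unfold eta; split_ifs <;> norm_num

theorem annih_apply (u : Fin (d + 2) → ℝ) (n : ℕ) (v : Fock d) :
    annih u n v = ∑ μ, ((-(u μ * ((n : ℝ) + 1)) : ℝ) : ℂ) • MvPolynomial.pderiv (μ, n) v := by
  rw [annih, ← Derivation.coeFnAddMonoidHom_apply, map_sum, Finset.sum_apply]
  rfl

theorem kdot_pos (p u : Fin (d + 2) → ℝ) (n : ℕ) (v : Fock d) :
    kdot p u ((n : ℤ) + 1) v = annih u n v := by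
  rw [annih_apply]
  simp only [kdot, alpha_pos, LinearMap.sum_apply, LinearMap.smul_apply, smul_smul]
  refine Finset.sum_congr rfl fun μ _ => ?_
  congr 1
  rw [← Complex.ofReal_mul]
  congr 1
  linear_combination (-(u μ * ((n : ℝ) + 1))) * eta_mul_self μ

theorem annih_X (u : Fin (d + 2) → ℝ) (n : ℕ) (μ : Fin (d + 2)) (m : ℕ) :
    annih u n (MvPolynomial.X (μ, m)) =
      if m = n then MvPolynomial.C ((-(u μ * ((n : ℝ) + 1)) : ℝ) : ℂ) else 0 := by
  classical
  rw [annih_apply, Finset.sum_eq_single μ]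
  · rw [MvPolynomial.pderiv_X, Pi.single_apply]
    by_cases hm : m = n
    · simp [hm, MvPolynomial.smul_eq_C_mul]
    · simp [hm]
  · intro ν _ hν
    rw [MvPolynomial.pderiv_X, Pi.single_apply, if_neg (by simp [hν.symm]), smul_zero]
  · simp

theorem annih_lin (u v : Fin (d + 2) → ℝ) (n m : ℕ) :
    annih u n (lin v m) =
      if m = n then MvPolynomial.C ((-(mdot u v * ((n : ℝ) + 1)) : ℝ) : ℂ) else 0 := by
  have h : annih u n (lin v m) =
      ∑ μ, ((eta μ * v μ : ℝ) : ℂ) • annih u n (MvPolynomial.X (μ, m)) := by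
    rw [lin, map_sum]
    exact Finset.sum_congr rfl fun μ _ => Derivation.map_smul _ _ _
  rw [h]
  simp only [annih_X]
  split_ifs
  · simp only [MvPolynomial.smul_eq_C_mul, ← MvPolynomial.C_mul, ← map_sum, ← Complex.ofReal_mul,
      ← Complex.ofReal_sum]
    congr 2
    simp only [mdot]
    rw [Finset.sum_mul, ← Finset.sum_neg_distrib]
    exact Finset.sum_congr rfl fun μ _ => by ring
  · simp only [smul_zero, Finset.sum_const_zero]

/-- Derivations are determined by their values on generators, so each annihilation operator is
identified by testing it on the three kinds of light-cone variables. -/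
theorem derivation_lcEquiv {k l : Fin (d + 2) → ℝ} (h : IsNullPair k l)
    (D : Derivation ℂ (Fock d) (Fock d))
    (D' : Derivation ℂ (MvPolynomial (LCIndex d) ℂ) (MvPolynomial (LCIndex d) ℂ))
    (hD : ∀ i, D (lcVar k l i) = lcEquiv h (D' (MvPolynomial.X i)))
    (f : MvPolynomial (LCIndex d) ℂ) : D (lcEquiv h f) = lcEquiv h (D' f) := by
  induction f using MvPolynomial.induction_on with
  | C a =>
    rw [← MvPolynomial.algebraMap_eq, AlgEquiv.commutes, Derivation.map_algebraMap,
      Derivation.map_algebraMap, map_zero]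
  | add f g hf hg => simp only [map_add, hf, hg]
  | mul_X f i hf =>
    rw [map_mul, Derivation.leibniz, Derivation.leibniz, hf, lcEquiv_X, hD]
    simp only [smul_eq_mul, map_add, map_mul, lcEquiv_X]

/-- k pairs to 1 with l and to 0 with k and the transversal directions, so k·α_{n+1} differentiates
l-variables only. This is why `ydeg` counts them. -/
theorem kdot_left_pos {k l : Fin (d + 2) → ℝ} (h : IsNullPair k l) (p : Fin (d + 2) → ℝ) (n : ℕ)
    (f : MvPolynomial (LCIndex d) ℂ) : kdot p k ((n : ℤ) + 1) (lcEquiv h f) =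
      lcEquiv h ((-((n : ℂ) + 1)) • MvPolynomial.pderiv (.inl n) f) := by
  classical
  rw [kdot_pos, derivation_lcEquiv h _ ((-((n : ℂ) + 1)) • MvPolynomial.pderiv (.inl n))]
  · rfl
  rintro (m | m | x)
  · rw [lcVar, annih_lin, h.mdot_eq_one, Derivation.smul_apply, MvPolynomial.pderiv_X,
      Pi.single_apply]
    by_cases hm : m = n
    · simp [hm, MvPolynomial.smul_eq_C_mul]
    · simp [hm]
  · simp [lcVar, annih_lin, h.left_null, MvPolynomial.pderiv_X]
  · simp [lcVar, annih_X, h.left_transv, MvPolynomial.pderiv_X]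

theorem kdot_right_pos {k l : Fin (d + 2) → ℝ} (h : IsNullPair k l) (p : Fin (d + 2) → ℝ) (n : ℕ)
    (f : MvPolynomial (LCIndex d) ℂ) : kdot p l ((n : ℤ) + 1) (lcEquiv h f) =
      lcEquiv h ((-((n : ℂ) + 1)) • MvPolynomial.pderiv (.inr (.inl n)) f) := by
  classical
  rw [kdot_pos, derivation_lcEquiv h _ ((-((n : ℂ) + 1)) • MvPolynomial.pderiv (.inr (.inl n)))]
  · rfl
  rintro (m | m | x)
  · simp [lcVar, annih_lin, h.symm.left_null, MvPolynomial.pderiv_X]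
  · rw [lcVar, annih_lin, h.symm.mdot_eq_one, Derivation.smul_apply, MvPolynomial.pderiv_X,
      Pi.single_apply]
    by_cases hm : m = n
    · simp [hm, MvPolynomial.smul_eq_C_mul]
    · simp [hm]
  · simp [lcVar, annih_X, h.right_transv, MvPolynomial.pderiv_X]

theorem alpha_transv_pos {k l : Fin (d + 2) → ℝ} (h : IsNullPair k l) (p : Fin (d + 2) → ℝ)
    (j : Fin d) (n : ℕ) (f : MvPolynomial (LCIndex d) ℂ) :
    alpha p (transv j) ((n : ℤ) + 1) (lcEquiv h f) =
      lcEquiv h (((n : ℂ) + 1) • MvPolynomial.pderiv (.inr (.inr (toLex (n, j)))) f) := by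
  classical
  have h1 : ∀ v, alpha p (transv j) ((n : ℤ) + 1) v =
      (((n : ℂ) + 1) • MvPolynomial.pderiv (R := ℂ) (transv j, n)) v := by
    intro v
    rw [alpha_pos, eta_transv]
    simp
  have h2 : ∀ u : Fin (d + 2) → ℝ, (∀ j, u (transv j) = 0) → ∀ m,
      MvPolynomial.pderiv (R := ℂ) (transv j, n) (lin u m) = 0 := by
    intro u hu m
    rw [lin_eq hu]
    simp [MvPolynomial.pderiv_X, transv_ne_zero, transv_ne_last]
  rw [h1, derivation_lcEquiv h _
    (((n : ℂ) + 1) • MvPolynomial.pderiv (.inr (.inr (toLex (n, j)))))]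
  · rfl
  rintro (m | m | x)
  · simp [lcVar, h2 _ h.right_transv, MvPolynomial.pderiv_X]
  · simp [lcVar, h2 _ h.left_transv, MvPolynomial.pderiv_X]
  · obtain ⟨⟨m, i⟩, rfl⟩ := toLex.surjective x
    simp only [lcVar, Derivation.smul_apply, MvPolynomial.pderiv_X, Pi.single_apply, ofLex_toLex]
    by_cases hx : m = n ∧ i = j
    · simp [hx]
    · rw [if_neg, if_neg]
      · simp
      · simp only [Sum.inr.injEq, toLex_inj, Prod.mk.injEq]
        exact hx
      · simp only [Prod.mk.injEq, transv_injective.eq_iff]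
        exact fun e => hx e.symm

/-! ### The lexicographic filtration -/

/-- The degree in the variables `l · α_{-(n+1)}`. -/
def ydeg (a : LCIndex d →₀ ℕ) : ℕ :=
  Finsupp.weight (Sum.elim (fun _ => 1) fun _ => 0 : LCIndex d → ℕ) a

/-- The level reduced by the degree in the variables `k · α_{-(n+1)}`. -/
def rdeg (a : LCIndex d →₀ ℕ) : ℕ :=
  Finsupp.weight (Sum.elim (fun n => n + 1) (Sum.elim (fun n => n) fun x => (ofLex x).1 + 1) :
    LCIndex d → ℕ) a

theorem ydeg_add (a b : LCIndex d →₀ ℕ) : ydeg (a + b) = ydeg a + ydeg b := map_add _ _ _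

theorem rdeg_add (a b : LCIndex d →₀ ℕ) : rdeg (a + b) = rdeg a + rdeg b := map_add _ _ _

theorem ydeg_single (i : LCIndex d) :
    ydeg (Finsupp.single i 1) = (Sum.elim (fun _ => 1) fun _ => 0 : LCIndex d → ℕ) i := by
  simp [ydeg, Finsupp.weight_single]

theorem rdeg_single (i : LCIndex d) :
    rdeg (Finsupp.single i 1) = (Sum.elim (fun n => n + 1)
      (Sum.elim (fun n => n) fun x => (ofLex x).1 + 1) : LCIndex d → ℕ) i := by
  simp [rdeg, Finsupp.weight_single]

section

variable {k l : Fin (d + 2) → ℝ} (h : IsNullPair k l)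

/-- The monomials in the light-cone variables. -/
def lcMonomial (a : LCIndex d →₀ ℕ) : Fock d := lcEquiv h (MvPolynomial.monomial a 1)

/-- The span of the light-cone monomials that precede `(s, t)` in the lexicographic order of
`(ydeg, rdeg)`. -/
def fil (s t : ℤ) : Submodule ℂ (Fock d) :=
  Submodule.span ℂ (lcMonomial h '' {a | (ydeg a : ℤ) < s ∨ (ydeg a : ℤ) = s ∧ (rdeg a : ℤ) ≤ t})

/-- `T` shifts the lexicographic filtration by `(i, j)`. -/
def Shifts (T : Op d) (i j : ℤ) : Prop := ∀ s t, ∀ v ∈ fil h s t, T v ∈ fil h (s + i) (t + j)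

variable {h}

theorem fil_mono {s t s' t' : ℤ} (hst : s < s' ∨ s = s' ∧ t ≤ t') : fil h s t ≤ fil h s' t' := by
  refine Submodule.span_mono (Set.image_mono fun a ha => ?_)
  simp only [Set.mem_ofPred_eq] at ha ⊢
  omega

theorem lcMonomial_mem_fil {a : LCIndex d →₀ ℕ} {s t : ℤ}
    (ha : (ydeg a : ℤ) < s ∨ (ydeg a : ℤ) = s ∧ (rdeg a : ℤ) ≤ t) : lcMonomial h a ∈ fil h s t :=
  Submodule.subset_span ⟨a, ha, rfl⟩

theorem lcMonomial_add (a b : LCIndex d →₀ ℕ) :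
    lcMonomial h (a + b) = lcMonomial h a * lcMonomial h b := by
  rw [lcMonomial, lcMonomial, lcMonomial, ← map_mul, MvPolynomial.monomial_mul, one_mul]

theorem lcMonomial_zero : lcMonomial h 0 = 1 := map_one (lcEquiv h)

theorem lcMonomial_single (i : LCIndex d) : lcMonomial h (Finsupp.single i 1) = lcVar k l i :=
  lcEquiv_X h i

namespace Shifts

theorem of_lcMonomial {T : Op d} {i j : ℤ}
    (hT : ∀ a, T (lcMonomial h a) ∈ fil h (ydeg a + i) (rdeg a + j)) : Shifts h T i j := by
  intro s t v hv
  have : fil h s t ≤ (fil h (s + i) (t + j)).comap T := by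
    refine Submodule.span_le.2 ?_
    rintro _ ⟨a, ha, rfl⟩
    simp only [Set.mem_ofPred_eq] at ha
    exact fil_mono (by omega) (hT a)
  exact this hv

/-- Lexicographic order: a drop in the first index pays for any second index. -/
theorem mono {T : Op d} {i j i' j' : ℤ} (hT : Shifts h T i j) (hij : i < i' ∨ i = i' ∧ j ≤ j') :
    Shifts h T i' j' := fun s t v hv => fil_mono (by omega) (hT s t v hv)

theorem zero (i j : ℤ) : Shifts h (0 : Op d) i j := fun s t v _ => by simp

theorem one : Shifts h (1 : Op d) 0 0 := fun s t v hv => by simpa using hv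

theorem smul {T : Op d} {i j : ℤ} (c : ℂ) (hT : Shifts h T i j) : Shifts h (c • T) i j :=
  fun s t v hv => Submodule.smul_mem _ c (hT s t v hv)

theorem add {S T : Op d} {i j : ℤ} (hS : Shifts h S i j) (hT : Shifts h T i j) :
    Shifts h (S + T) i j := fun s t v hv => Submodule.add_mem _ (hS s t v hv) (hT s t v hv)

theorem sub {S T : Op d} {i j : ℤ} (hS : Shifts h S i j) (hT : Shifts h T i j) :
    Shifts h (S - T) i j := fun s t v hv => Submodule.sub_mem _ (hS s t v hv) (hT s t v hv)

theorem sum {ι : Type} (s : Finset ι) {T : ι → Op d} {i j : ℤ} (hT : ∀ x, Shifts h (T x) i j) :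
    Shifts h (∑ x ∈ s, T x) i j := fun s' t v hv => by
  rw [LinearMap.sum_apply]
  exact Submodule.sum_mem _ fun x _ => hT x s' t v hv

theorem mul {S T : Op d} {i j i' j' : ℤ} (hS : Shifts h S i j) (hT : Shifts h T i' j') :
    Shifts h (S * T) (i + i') (j + j') := fun s t v hv => by
  have := hS _ _ _ (hT s t v hv)
  rwa [add_assoc, add_assoc, add_comm i', add_comm j'] at this

theorem mul_of_le {S T : Op d} {i j i' j' m n : ℤ} (hS : Shifts h S i j) (hT : Shifts h T i' j')
    (hmn : i + i' < m ∨ i + i' = m ∧ j + j' ≤ n) : Shifts h (S * T) m n :=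
  (hS.mul hT).mono hmn

/-- A locally finite sum, up to finitely many leading parts `S x`, `x ∈ s`. -/
theorem locSum_sub {ι : Type} [DecidableEq ι] {T : ι → Op d} (hf : ∀ v, {x | T x v ≠ 0}.Finite)
    (s : Finset ι) (S : ι → Op d) {i j : ℤ}
    (hT : ∀ x, Shifts h (T x - if x ∈ s then S x else 0) i j) :
    Shifts h (locSum T hf - ∑ x ∈ s, S x) i j := by
  intro s' t v hv
  have h1 : (locSum T hf - ∑ x ∈ s, S x) v =
      ∑ᶠ x, (T x - if x ∈ s then S x else 0) v := by
    have h2 : (∑ x ∈ s, S x) v = ∑ᶠ x, (if x ∈ s then S x else 0 : Op d) v := by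
      rw [finsum_eq_sum_of_support_subset (s := s), LinearMap.sum_apply]
      · exact Finset.sum_congr rfl fun x hx => by rw [if_pos hx]
      · intro x hx
        by_contra hxs
        simp only [Finset.mem_coe] at hxs
        simp [hxs] at hx
    rw [LinearMap.sub_apply, h2]
    simp only [LinearMap.sub_apply]
    refine (finsum_sub_distrib (hf v) (s.finite_toSet.subset fun x hx => ?_)).symm
    by_contra hxs
    simp only [Finset.mem_coe] at hxs
    simp [hxs] at hx
  rw [h1]
  exact finsum_induction (· ∈ fil h (s' + i) (t + j)) (Submodule.zero_mem _)
    (fun _ _ => Submodule.add_mem _) fun x => hT x s' t v hv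

theorem locSum {ι : Type} {T : ι → Op d} (hf : ∀ v, {x | T x v ≠ 0}.Finite) {i j : ℤ}
    (hT : ∀ x, Shifts h (T x) i j) : Shifts h (locSum T hf) i j := by
  classical
  simpa using locSum_sub hf ∅ 0 (by simpa using hT)

theorem mulLeft (a : LCIndex d →₀ ℕ) :
    Shifts h (LinearMap.mulLeft ℂ (lcMonomial h a)) (ydeg a) (rdeg a) := by
  refine of_lcMonomial fun b => ?_
  rw [LinearMap.mulLeft_apply, ← lcMonomial_add]
  refine lcMonomial_mem_fil ?_
  rw [ydeg_add, rdeg_add]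
  omega

theorem of_pderiv {T : Op d} {c : ℂ} {x : LCIndex d}
    (hT : ∀ f, T (lcEquiv h f) = lcEquiv h (c • MvPolynomial.pderiv x f)) :
    Shifts h T (-(ydeg (Finsupp.single x 1) : ℤ)) (-(rdeg (Finsupp.single x 1) : ℤ)) := by
  refine of_lcMonomial fun a => ?_
  rw [lcMonomial, hT, MvPolynomial.pderiv_monomial]
  by_cases hx : a x = 0
  · simp [hx]
  · have h1 : Finsupp.single x 1 ≤ a := by
      rw [Finsupp.single_le_iff]; omega
    have h2 : c • MvPolynomial.monomial (a - Finsupp.single x 1) (1 * ((a x : ℕ) : ℂ)) =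
        (c * ((a x : ℕ) : ℂ)) • MvPolynomial.monomial (R := ℂ) (a - Finsupp.single x 1) 1 := by
      simp [MvPolynomial.smul_monomial]
    rw [h2, map_smul]
    refine Submodule.smul_mem _ _ (lcMonomial_mem_fil ?_)
    have h3 := ydeg_add (a - Finsupp.single x 1) (Finsupp.single x 1)
    have h4 := rdeg_add (a - Finsupp.single x 1) (Finsupp.single x 1)
    rw [tsub_add_cancel_of_le h1] at h3 h4
    omega

end Shifts

/-! ### Shifts of the oscillators -/

theorem int_cases {P : ℤ → Prop} (zero : P 0) (pos : ∀ n : ℕ, P (n + 1))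
    (neg : ∀ n : ℕ, P (-(n + 1))) (m : ℤ) : P m := by
  match m with
  | .ofNat 0 => exact zero
  | .ofNat (n + 1) => exact pos n
  | .negSucc n => rw [Int.negSucc_eq]; exact neg n

variable (h) (p : Fin (d + 2) → ℝ)

theorem kdot_left_neg (n : ℕ) : kdot p k (-((n : ℤ) + 1)) =
    LinearMap.mulLeft ℂ (lcMonomial h (Finsupp.single (.inr (.inl n)) 1)) := by
  rw [kdot_neg, lcMonomial_single]
  rfl

theorem kdot_right_neg (n : ℕ) : kdot p l (-((n : ℤ) + 1)) =
    LinearMap.mulLeft ℂ (lcMonomial h (Finsupp.single (.inl n) 1)) := by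
  rw [kdot_neg, lcMonomial_single]
  rfl

theorem alpha_transv_neg (j : Fin d) (n : ℕ) : alpha p (transv j) (-((n : ℤ) + 1)) =
    LinearMap.mulLeft ℂ (lcMonomial h (Finsupp.single (.inr (.inr (toLex (n, j)))) 1)) := by
  rw [alpha_neg, lcMonomial_single]
  rfl

/-- The second index is arbitrary because differentiating in an l-variable lowers `ydeg`. -/
theorem shifts_kdot_left_of_pos {m : ℤ} (hm : 0 < m) (j : ℤ) : Shifts h (kdot p k m) 0 j := by
  induction m using int_cases with
  | zero => omega
  | pos n =>
    refine (Shifts.of_pderiv (kdot_left_pos h p n)).mono ?_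
    simp [ydeg_single]
  | neg n => omega

/-- The gain of one over -m is the discount that `rdeg` gives to k-variables. The zero mode is a
scalar without this gain, and it produces the leading term of L_{-n}. -/
theorem shifts_kdot_left {m : ℤ} (hm : m ≠ 0) : Shifts h (kdot p k m) 0 (-m - 1) := by
  induction m using int_cases with
  | zero => omega
  | pos n => exact shifts_kdot_left_of_pos h p (by omega) _
  | neg n =>
    rw [kdot_left_neg h]
    refine (Shifts.mulLeft _).mono ?_
    simp [ydeg_single, rdeg_single]

theorem shifts_kdot_right_nonneg {m : ℤ} (hm : 0 ≤ m) : Shifts h (kdot p l m) 0 0 := by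
  induction m using int_cases with
  | zero => rw [kdot_zero]; exact Shifts.smul _ Shifts.one
  | pos n =>
    refine (Shifts.of_pderiv (kdot_right_pos h p n)).mono ?_
    simp [ydeg_single]
  | neg n => omega

/-- Only creation operators use up the first index 1; for m ≥ 0 the operator does not raise `ydeg`.
-/
theorem shifts_kdot_right (m : ℤ) : Shifts h (kdot p l m) 1 (-m) := by
  induction m using int_cases with
  | zero => exact (shifts_kdot_right_nonneg h p le_rfl).mono (by omega)
  | pos n => exact (shifts_kdot_right_nonneg h p (by omega)).mono (by omega)
  | neg n =>
    rw [kdot_right_neg h]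
    refine (Shifts.mulLeft _).mono ?_
    simp [ydeg_single, rdeg_single]

theorem shifts_alpha_transv (j : Fin d) (m : ℤ) : Shifts h (alpha p (transv j) m) 0 (-m) := by
  induction m using int_cases with
  | zero => rw [alpha_zero]; exact Shifts.smul _ Shifts.one
  | pos n =>
    refine (Shifts.of_pderiv (alpha_transv_pos h p j n)).mono ?_
    simp [ydeg_single, rdeg_single]
  | neg n =>
    rw [alpha_transv_neg h]
    refine (Shifts.mulLeft _).mono ?_
    simp [ydeg_single, rdeg_single]

/-! ### The leading part of the Virasoro operators -/

theorem kdot_eq {u : Fin (d + 2) → ℝ} (hu : ∀ j, u (transv j) = 0) (m : ℤ) :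
    kdot p u m = (u 0 : ℂ) • alpha p 0 m -
      (u (Fin.last (d + 1)) : ℂ) • alpha p (Fin.last (d + 1)) m := by
  rw [kdot, sum_split]
  simp only [hu, eta_zero, eta_last, mul_zero, Complex.ofReal_zero, zero_smul,
    Finset.sum_const_zero, add_zero, one_mul]
  push_cast
  module

/-- This is the metric in light-cone form, k ⊗ l + l ⊗ k minus the transversal part. -/
theorem sum_alpha_mul_alpha (h : IsNullPair k l) (a b : ℤ) : ∑ μ, (eta μ : ℂ) • (alpha p μ a * alpha p μ b) =
    kdot p k a * kdot p l b + kdot p l a * kdot p k b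
      - ∑ j : Fin d, alpha p (transv j) a * alpha p (transv j) b := by
  have h1 : (k 0 : ℂ) * l 0 = 1 / 2 := by
    rw [← Complex.ofReal_mul, h.zero_mul_zero]; norm_num
  have h2 : (k (Fin.last (d + 1)) : ℂ) * l (Fin.last (d + 1)) = -(1 / 2) := by
    rw [← Complex.ofReal_mul, h.last_mul_last]; norm_num
  have h3 : (k 0 : ℂ) * l (Fin.last (d + 1)) + k (Fin.last (d + 1)) * l 0 = 0 := by
    exact_mod_cast congrArg Complex.ofReal h.cross
  have h4 : ∑ j : Fin d, (eta (transv j) : ℂ) • (alpha p (transv j) a * alpha p (transv j) b) =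
      -∑ j : Fin d, alpha p (transv j) a * alpha p (transv j) b := by
    rw [← Finset.sum_neg_distrib]
    exact Finset.sum_congr rfl fun j _ => by
      rw [eta_transv, Complex.ofReal_neg, Complex.ofReal_one]
      exact neg_one_smul ℂ (M := Op d) _
  rw [sum_split, h4, kdot_eq p h.left_transv, kdot_eq p h.left_transv, kdot_eq p h.right_transv,
    kdot_eq p h.right_transv]
  simp only [eta_zero, eta_last, sub_mul, mul_sub, smul_mul_smul_comm, Complex.ofReal_neg,
    Complex.ofReal_one]
  linear_combination (norm := module) (-(2 * h1)) • (alpha p 0 a * alpha p 0 b)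
    + h3 • (alpha p 0 a * alpha p (Fin.last (d + 1)) b)
    + h3 • (alpha p (Fin.last (d + 1)) a * alpha p 0 b)
    - (2 * h2) • (alpha p (Fin.last (d + 1)) a * alpha p (Fin.last (d + 1)) b)

/-- Each longitudinal product contains k·α with a nonzero mode, which gains the -1; the transversal
products do not raise `ydeg`. Neither argument depends on the order of the factors, so normal
ordering is harmless. -/
theorem shifts_sum_alpha_mul_alpha {a b : ℤ} (ha : a ≠ 0) (hb : b ≠ 0) :
    Shifts h (∑ μ, (eta μ : ℂ) • (alpha p μ a * alpha p μ b)) 1 (-(a + b) - 1) := by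
  rw [sum_alpha_mul_alpha p h]
  refine ((Shifts.mul_of_le (shifts_kdot_left h p ha) (shifts_kdot_right h p b) (by omega)).add
    (Shifts.mul_of_le (shifts_kdot_right h p a) (shifts_kdot_left h p hb) (by omega))).sub
    (Shifts.sum _ fun j => ?_)
  exact Shifts.mul_of_le (shifts_alpha_transv h p j a) (shifts_alpha_transv h p j b) (by omega)

theorem shifts_sum_alpha_mul_alpha_zero (hkp : mdot k p = -1) (n : ℕ) :
    Shifts h (∑ μ, (eta μ : ℂ) • (alpha p μ (-((n : ℤ) + 1)) * alpha p μ 0)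
      + kdot p l (-((n : ℤ) + 1))) 1 n := by
  rw [sum_alpha_mul_alpha p h, kdot_zero p k, hkp]
  have h1 : kdot p l (-((n : ℤ) + 1)) * (((-1 : ℝ) : ℂ) • (1 : Op d)) =
      -kdot p l (-((n : ℤ) + 1)) := by
    rw [mul_smul_comm, mul_one, Complex.ofReal_neg, Complex.ofReal_one]
    exact neg_one_smul ℂ (M := Op d) _
  rw [h1, add_sub_right_comm, neg_add_cancel_right]
  refine (Shifts.mul_of_le (shifts_kdot_left h p (by omega)) (shifts_kdot_right h p 0)
    (by omega)).sub (Shifts.sum _ fun j => ?_)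
  exact Shifts.mul_of_le (shifts_alpha_transv h p j _) (shifts_alpha_transv h p j 0) (by omega)

/-- Two summands contain a zero mode, each contributes -l·α_{-(n+1)}, and the prefactor -1/2 makes
the leading coefficient exactly 1. -/
theorem shifts_virasoro_sub (hkp : mdot k p = -1) (c : ℝ) (n : ℕ) :
    Shifts h (virasoro p c (-((n : ℤ) + 1)) - kdot p l (-((n : ℤ) + 1))) 1 n := by
  have h1 := Shifts.locSum_sub (h := h) (i := 1) (j := n) (virasoro_finite p (-((n : ℤ) + 1)))
    {0, -((n : ℤ) + 1)} (fun _ => -kdot p l (-((n : ℤ) + 1))) (fun x => ?_)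
  · rw [Finset.sum_pair (by omega)] at h1
    have h2 := h1.smul (-(1 / 2))
    rw [virasoro, if_neg (by omega), zero_smul, sub_zero]
    convert h2 using 1
    rw [smul_sub]
    module
  · split_ifs with hx
    · rw [sub_neg_eq_add]
      simp only [Finset.mem_insert, Finset.mem_singleton] at hx
      -- Normal ordering puts both zero-mode summands into the form α_{-(n+1)} α_0.
      convert shifts_sum_alpha_mul_alpha_zero h p hkp n using 5 with μ
      rw [wick]
      rcases hx with rfl | rfl
      · rw [if_pos (by omega), sub_zero]
      · rw [if_neg (by omega), sub_self]
    · simp only [Finset.mem_insert, Finset.mem_singleton, not_or] at hx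
      rw [sub_zero]
      simp only [wick]
      split_ifs with hle
      · exact (shifts_sum_alpha_mul_alpha h p (by omega) (by omega)).mono (by omega)
      · exact (shifts_sum_alpha_mul_alpha h p (by omega) (by omega)).mono (by omega)

/-! ### The leading part of the DDF operators -/

theorem kdot_smul (c : ℝ) (u : Fin (d + 2) → ℝ) (m : ℤ) :
    kdot p (c • u) m = (c : ℂ) • kdot p u m := by
  simp only [kdot, Finset.smul_sum, smul_smul, Pi.smul_apply, smul_eq_mul, Complex.ofReal_mul]
  exact Finset.sum_congr rfl fun μ _ => by congr 1; ring

/-- For n > 0 every term ends in some k·α_l with l > 0, which lowers `ydeg`. -/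
theorem shifts_U (c : ℝ) (n : ℕ) :
    Shifts h (U p (c • k) n) 0 0 ∧ (n ≠ 0 → ∀ j, Shifts h (U p (c • k) n) 0 j) := by
  induction n using Nat.strong_induction_on with
  | _ n ih =>
    cases n with
    | zero => rw [U]; exact ⟨Shifts.one, by simp⟩
    | succ n =>
      have h1 : ∀ j, Shifts h (U p (c • k) (n + 1)) 0 j := fun j => by
        rw [U]
        refine Shifts.smul _ (Shifts.sum _ fun x => ?_)
        rw [kdot_smul]
        refine Shifts.mul_of_le (ih (n - x) (by omega)).1
          ((shifts_kdot_left_of_pos h p (by omega) j).smul _) (by omega)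
      exact ⟨h1 0, fun _ => h1⟩

/-- For n > 0 every term has at least one creation factor k·α_{-l}, hence the gain of one. -/
theorem shifts_Udag (c : ℝ) (n : ℕ) :
    Shifts h (Udag p (c • k) n) 0 n ∧ (n ≠ 0 → Shifts h (Udag p (c • k) n) 0 (n - 1)) := by
  induction n using Nat.strong_induction_on with
  | _ n ih =>
    cases n with
    | zero => rw [Udag]; exact ⟨Shifts.one, by simp⟩
    | succ n =>
      have h1 : Shifts h (Udag p (c • k) (n + 1)) 0 n := by
        rw [Udag]
        refine Shifts.smul _ (Shifts.sum _ fun x => ?_)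
        rw [kdot_smul]
        have := x.2
        refine Shifts.mul_of_le ((shifts_kdot_left h p (by omega)).smul _)
          (ih (n - x) (by omega)).1 (by omega)
      exact ⟨h1.mono (by omega), fun _ => h1.mono (by omega)⟩

theorem shifts_UZ_zero (c : ℝ) (r : ℤ) : Shifts h (UZ p (c • k) r) 0 0 := by
  rw [UZ]
  split_ifs
  · exact Shifts.zero _ _
  · exact (shifts_U h p c _).1

theorem shifts_UZ (c : ℝ) {r : ℤ} (hr : r ≠ 0) (j : ℤ) : Shifts h (UZ p (c • k) r) 0 j := by
  rw [UZ]
  split_ifs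
  · exact Shifts.zero _ _
  · exact (shifts_U h p c _).2 (by omega) j

theorem shifts_UdagZ' (c : ℝ) (r : ℤ) : Shifts h (UdagZ p (c • k) r) 0 r := by
  rw [UdagZ]
  split_ifs
  · exact Shifts.zero _ _
  · exact (shifts_Udag h p c _).1.mono (by omega)

theorem shifts_UdagZ (c : ℝ) {r : ℤ} (hr : r ≠ 0) : Shifts h (UdagZ p (c • k) r) 0 (r - 1) := by
  rw [UdagZ]
  split_ifs
  · exact Shifts.zero _ _
  · exact ((shifts_Udag h p c _).2 (by omega)).mono (by omega)

/-- In the term r = 0 only U_{-n}^† remains, and its index is nonzero; in the others U_r lowers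
`ydeg` or vanishes. -/
theorem shifts_V (c : ℝ) {n : ℤ} (hn : n ≠ 0) : Shifts h (V p (c • k) n) 0 (-n - 1) := by
  refine Shifts.locSum _ fun r => ?_
  rw [← neg_smul]
  by_cases hr : r = 0
  · subst hr
    exact Shifts.mul_of_le (shifts_UdagZ h p (-c) (r := 0 - n) (by omega)) (shifts_UZ_zero h p c 0)
      (by omega)
  · exact Shifts.mul_of_le (shifts_UdagZ' h p (-c) (r - n)) (shifts_UZ h p c hr (-r - 1)) (by omega)

theorem UZ_zero (q : Fin (d + 2) → ℝ) : UZ p q 0 = 1 := by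
  rw [UZ, if_neg (lt_irrefl 0), Int.toNat_zero, U]

theorem UdagZ_zero (q : Fin (d + 2) → ℝ) : UdagZ p q 0 = 1 := by
  rw [UdagZ, if_neg (lt_irrefl 0), Int.toNat_zero, Udag]

theorem shifts_V_zero (c : ℝ) : Shifts h (V p (c • k) 0 - 1) 0 (-1) := by
  have h1 := Shifts.locSum_sub (h := h) (i := 0) (j := -1) (V_finite p (c • k) 0) {0} (fun _ => 1)
    (fun r => ?_)
  · rwa [Finset.sum_singleton] at h1
  · rw [← neg_smul]
    split_ifs with hr
    · rw [Finset.mem_singleton] at hr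
      subst hr
      rw [sub_zero, UZ_zero, UdagZ_zero, one_mul, sub_self]
      exact Shifts.zero _ _
    · rw [sub_zero]
      rw [Finset.mem_singleton] at hr
      exact Shifts.mul_of_le (shifts_UdagZ' h p (-c) (r - 0)) (shifts_UZ h p c hr (-r - 1))
        (by omega)

/-- The leading term α^j_{-(n+1)} has `rdeg` n + 1. It comes from α^j_{-(n+1)} V_0, with V_0 equal
to 1 up to lower terms; every other summand carries a V of nonzero mode and loses at least one. -/
theorem shifts_ddf_sub (j : Fin d) (n : ℕ) :
    Shifts h (ddf p k j (-((n : ℤ) + 1)) - alpha p (transv j) (-((n : ℤ) + 1))) 0 n := by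
  rw [ddf, Vvec, add_sub_right_comm]
  set c : ℝ := ((-((n : ℤ) + 1) : ℤ) : ℝ)
  refine Shifts.add ?_ (((shifts_V h p c (by omega)).mono (by omega)).smul _)
  -- The summation index of `Vbar` is one less than the mode, so index n is the summand with V_0.
  have h1 := Shifts.locSum_sub (h := h) (i := 0) (j := n)
    (Vbar_finite p (c • k) (transv j) (-((n : ℤ) + 1))) {n}
    (fun _ => alpha p (transv j) (-((n : ℤ) + 1))) (fun r => ?_)
  · rwa [Finset.sum_singleton] at h1
  · have h2 : Shifts h (V p (c • k) (-((n : ℤ) + 1) - ((r : ℤ) + 1)) *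
        alpha p (transv j) ((r : ℤ) + 1)) 0 n :=
      Shifts.mul_of_le (shifts_V h p c (by omega)) (shifts_alpha_transv h p j _) (by omega)
    rw [add_sub_right_comm]
    refine Shifts.add ?_ h2
    split_ifs with hr
    · rw [Finset.mem_singleton] at hr
      subst hr
      rw [neg_add_cancel]
      convert Shifts.mul_of_le (shifts_alpha_transv h p j (-((r : ℤ) + 1))) (shifts_V_zero h p c)
        (m := 0) (n := r) (by omega) using 1
      rw [mul_sub, mul_one]
    · rw [Finset.mem_singleton] at hr
      rw [sub_zero]
      exact Shifts.mul_of_le (shifts_alpha_transv h p j _) (shifts_V h p c (by omega)) (by omega)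

end

end CovariantString

/-! ### Triangular families -/

/-- A family that is unitriangular with respect to a basis, for a well-founded order, is linearly
independent and generates. -/
theorem Module.Basis.linearIndependent_and_span_of_triangular {R V σ ι M : Type*} [Ring R]
    [AddCommGroup V] [Module R V] [LinearOrder M] [WellFoundedLT M] (b : Module.Basis σ R V)
    (m : σ → M) (v : ι → V) {e : ι → σ} (he : Function.Bijective e)
    (hv : ∀ i, v i - b (e i) ∈ Submodule.span R (b '' {a | m a < m (e i)})) :
    LinearIndependent R v ∧ Submodule.span R (Set.range v) = ⊤ := by
  constructor
  · have hrepr : ∀ i a, m (e i) ≤ m a → b.repr (v i - b (e i)) a = 0 := by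
      intro i a hia
      have := b.mem_span_image.1 (hv i)
      by_contra hne
      exact absurd (this (Finsupp.mem_support_iff.2 hne)) (not_lt.2 hia)
    rw [linearIndependent_iff]
    intro c hc
    by_contra hne
    -- For `i` of maximal `m (e i)` in the support, the relation has coefficient `c i` at `b (e i)`:
    -- the other vectors have corrections strictly below their own value, and injectivity of `e`
    -- separates ties.
    obtain ⟨i, hi, hmax⟩ := c.support.exists_max_image (fun i => m (e i))
      (Finsupp.support_nonempty_iff.2 hne)
    refine Finsupp.mem_support_iff.1 hi ?_
    have h1 : b.repr (Finsupp.linearCombination R v c) (e i) = 0 := by rw [hc]; simp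
    rw [Finsupp.linearCombination_apply, Finsupp.sum, map_sum, Finsupp.finsetSum_apply,
      Finset.sum_eq_single i] at h1
    · have h2 := hrepr i (e i) le_rfl
      rw [map_sub, Finsupp.sub_apply, sub_eq_zero, b.repr_self, Finsupp.single_eq_same] at h2
      rwa [map_smul, Finsupp.smul_apply, h2, smul_eq_mul, mul_one] at h1
    · intro j hj hji
      have h2 := hrepr j (e i) (hmax j hj)
      rw [map_sub, Finsupp.sub_apply, sub_eq_zero, b.repr_self,
        Finsupp.single_eq_of_ne (fun h => hji (he.1 h).symm)] at h2
      rw [map_smul, Finsupp.smul_apply, h2, smul_zero]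
    · exact fun h => absurd hi h
  · have hb : ∀ x : M, ∀ a, m a = x → b a ∈ Submodule.span R (Set.range v) := by
      intro x
      induction x using WellFoundedLT.induction with
      | _ x ih =>
        intro a ha
        obtain ⟨i, rfl⟩ := he.2 a
        have h1 : Submodule.span R (b '' {a | m a < m (e i)}) ≤ Submodule.span R (Set.range v) :=
          Submodule.span_le.2 (by rintro _ ⟨a', ha', rfl⟩; exact ih _ (ha ▸ ha') a' rfl)
        have h2 := Submodule.sub_mem _ (Submodule.subset_span (Set.mem_range_self i)) (h1 (hv i))
        rwa [sub_sub_cancel] at h2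
    rw [eq_top_iff, ← b.span_eq]
    exact Submodule.span_le.2 (by rintro _ ⟨a, rfl⟩; exact hb _ a rfl)

theorem LinearIndependent.finsuppSingle_prod {R V X ι : Type*} [Ring R] [AddCommGroup V]
    [Module R V] {F : ι → V} (hF : LinearIndependent R F) :
    LinearIndependent R fun z : X × ι => Finsupp.single z.1 (F z.2) := by
  have h0 := Finsupp.linearIndependent_single (R := R) (ι := X) (φ := fun _ => ι) (fun _ => F)
    fun _ => hF
  exact h0.comp (fun z : X × ι => (⟨z.1, z.2⟩ : Σ _ : X, ι)) (by
    rintro ⟨x, i⟩ ⟨x', i'⟩ h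
    simpa using h)

/-- If the vectors `T x (w y)` are linearly independent, so are the vectors `T x (f i)` for a
linearly independent family `f` in the span of `w`. -/
theorem LinearIndependent.of_mem_span {R V X Y ι : Type*} [Ring R] [AddCommGroup V] [Module R V]
    {T : X → Module.End R V} {w : Y → V} (hw : LinearIndependent R fun z : X × Y => T z.1 (w z.2))
    {f : ι → V} (hf : LinearIndependent R f) (hfw : ∀ i, f i ∈ Submodule.span R (Set.range w)) :
    LinearIndependent R fun z : X × ι => T z.1 (f z.2) := by
  choose F hF using fun i => Finsupp.mem_span_range_iff_exists_finsupp.1 (hfw i)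
  have hFi : LinearIndependent R F := by
    refine LinearIndependent.of_comp (Finsupp.linearCombination R w) ?_
    rwa [show Finsupp.linearCombination R w ∘ F = f from funext hF]
  -- Independence of the vectors `T x (w y)` is injectivity of `G`, and `G` sends the coefficient
  -- vector of `f i`, placed at `x`, to `T x (f i)`.
  let G : (X →₀ Y →₀ R) →ₗ[R] V :=
    Finsupp.linearCombination R (fun z : X × Y => T z.1 (w z.2)) ∘ₗ
      (Finsupp.curryLinearEquiv R).symm.toLinearMap
  have hG : Function.Injective G := by
    have h1 : Function.Injective (Finsupp.linearCombination R fun z : X × Y => T z.1 (w z.2)) := hw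
    exact h1.comp (Finsupp.curryLinearEquiv R).symm.injective
  have h2 : ∀ x, T x ∘ₗ Finsupp.linearCombination R w = G ∘ₗ Finsupp.lsingle x := by
    intro x
    refine Finsupp.lhom_ext fun y c => ?_
    have h3 : (Finsupp.curryLinearEquiv R).symm (Finsupp.single x (Finsupp.single y c)) =
        Finsupp.single (x, y) c := by
      rw [LinearEquiv.symm_apply_eq]
      exact (Finsupp.curry_single (x, y) c).symm
    simp [G, h3]
  have h4 : LinearIndependent R (G ∘ fun z : X × ι => Finsupp.single z.1 (F z.2)) :=
    hFi.finsuppSingle_prod.map_injOn G hG.injOn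
  have h5 : (fun z : X × ι => T z.1 (f z.2)) =
      G ∘ fun z : X × ι => Finsupp.single z.1 (F z.2) := by
    funext z
    have h6 := LinearMap.congr_fun (h2 z.1) (F z.2)
    rw [← hF z.2]
    exact h6
  rw [h5]
  exact h4

namespace CovariantString

variable {d : ℕ}

/-! ### The basis of the Fock space -/

section

variable {k l : Fin (d + 2) → ℝ}

/-- The basis of the light-cone monomials. -/
def lcBasis (h : IsNullPair k l) : Module.Basis (LCIndex d →₀ ℕ) ℂ (Fock d) :=
  (MvPolynomial.basisMonomials _ ℂ).map (lcEquiv h).toLinearEquiv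

theorem lcBasis_apply (h : IsNullPair k l) (a : LCIndex d →₀ ℕ) :
    lcBasis h a = lcMonomial h a := by
  simp [lcBasis, lcMonomial]

/-- The leading part of `T` is multiplication by the light-cone monomial of exponent `a`. -/
def Leads (h : IsNullPair k l) (T : Op d) (a : LCIndex d →₀ ℕ) : Prop :=
  Shifts h (T - LinearMap.mulLeft ℂ (lcMonomial h a)) (ydeg a) (rdeg a - 1)

namespace Leads

variable {h : IsNullPair k l}

theorem one : Leads h (1 : Op d) 0 := by
  rw [Leads, lcMonomial_zero, LinearMap.mulLeft_one]
  convert Shifts.zero (h := h) _ _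
  exact sub_self _

/-- ST - ab = (S - a)T + a(T - b), where a and b are the leading monomials: either summand inherits
one drop in `rdeg`. -/
theorem mul {S T : Op d} {a b : LCIndex d →₀ ℕ} (hS : Leads h S a) (hT : Leads h T b) :
    Leads h (S * T) (a + b) := by
  have h1 : S * T - LinearMap.mulLeft ℂ (lcMonomial h (a + b)) =
      (S - LinearMap.mulLeft ℂ (lcMonomial h a)) * T +
        LinearMap.mulLeft ℂ (lcMonomial h a) * (T - LinearMap.mulLeft ℂ (lcMonomial h b)) := by
    rw [lcMonomial_add, LinearMap.mulLeft_mul, ← Module.End.mul_eq_comp]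
    rw [sub_mul, mul_sub, sub_add_sub_cancel]
  have h2 : Shifts h T (ydeg b) (rdeg b) := by
    have := (hT.mono (j' := rdeg b) (by omega)).add (Shifts.mulLeft (h := h) b)
    rwa [sub_add_cancel] at this
  rw [Leads, h1, ydeg_add, rdeg_add]
  exact (Shifts.mul_of_le hS h2 (by push_cast; omega)).add
    (Shifts.mul_of_le (Shifts.mulLeft a) hT (by push_cast; omega))

theorem pow {T : Op d} {a : LCIndex d →₀ ℕ} (hT : Leads h T a) (n : ℕ) :
    Leads h (T ^ n) (n • a) := by
  induction n with
  | zero => rw [pow_zero, zero_smul]; exact one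
  | succ n ih => rw [pow_succ, succ_nsmul]; exact ih.mul hT

theorem ordMonomial {ι : Type} [LinearOrder ι] {T : ι → Op d} {g : ι → LCIndex d}
    (hT : ∀ i, Leads h (T i) (Finsupp.single (g i) 1)) (e : ι →₀ ℕ) :
    Leads h (ordMonomial T e) (e.mapDomain g) := by
  have h1 : ∀ L : List ι, Leads h (L.map fun i => T i ^ e i).prod
      (L.map fun i => Finsupp.single (g i) (e i)).sum := by
    intro L
    induction L with
    | nil => exact one
    | cons i L ih =>
      rw [List.map_cons, List.prod_cons, List.map_cons, List.sum_cons]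
      refine mul ?_ ih
      simpa using (hT i).pow (e i)
  have h2 : e.mapDomain g = (e.support.sort.map fun i => Finsupp.single (g i) (e i)).sum := by
    rw [← List.sum_toFinset _ (Finset.sort_nodup _ _), Finset.sort_toFinset]
    rfl
  rw [h2]
  exact h1 _

theorem apply_one {T : Op d} {a : LCIndex d →₀ ℕ} (hT : Leads h T a) :
    T 1 - lcMonomial h a ∈ fil h (ydeg a) (rdeg a - 1) := by
  have h1 : (1 : Fock d) ∈ fil h 0 0 := by
    rw [← lcMonomial_zero (h := h)]
    exact lcMonomial_mem_fil (by simp [ydeg, rdeg])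
  have h2 := hT 0 0 1 h1
  rw [LinearMap.sub_apply, LinearMap.mulLeft_apply, mul_one] at h2
  simpa using h2

end Leads

/-- The exponent of the leading monomial. -/
def leadExp (x : (ℕ →₀ ℕ) × (ℕ →₀ ℕ) × (ℕ ×ₗ Fin d →₀ ℕ)) : LCIndex d →₀ ℕ :=
  x.1.mapDomain Sum.inl + (x.2.1.mapDomain (Sum.inr ∘ Sum.inl) +
    x.2.2.mapDomain (Sum.inr ∘ Sum.inr))

theorem leadExp_bijective : Function.Bijective (leadExp (d := d)) := by
  have h1 : leadExp (d := d) = ((Equiv.refl (ℕ →₀ ℕ)).prodCongr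
      Finsupp.sumFinsuppEquivProdFinsupp.symm).trans Finsupp.sumFinsuppEquivProdFinsupp.symm := by
    ext x i
    have h2 := Sum.inr_injective (α := ℕ).comp (Sum.inl_injective (α := ℕ) (β := ℕ ×ₗ Fin d))
    have h3 := Sum.inr_injective (α := ℕ).comp (Sum.inr_injective (α := ℕ) (β := ℕ ×ₗ Fin d))
    rw [leadExp, Finsupp.add_apply, Finsupp.add_apply]
    rcases i with n | n | y
    · rw [Finsupp.mapDomain_apply Sum.inl_injective,
        Finsupp.mapDomain_of_notMem_range _ _ (by simp),
        Finsupp.mapDomain_of_notMem_range _ _ (by simp)]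
      rfl
    · rw [Finsupp.mapDomain_of_notMem_range _ _ (by simp),
        Finsupp.mapDomain_of_notMem_range (f := Sum.inr ∘ Sum.inr) _ _ (by simp), zero_add, add_zero]
      exact Finsupp.mapDomain_apply h2 _ n
    · rw [Finsupp.mapDomain_of_notMem_range _ _ (by simp),
        Finsupp.mapDomain_of_notMem_range (f := Sum.inr ∘ Sum.inl) _ _ (by simp), zero_add, zero_add]
      exact Finsupp.mapDomain_apply h3 _ y
  rw [h1]
  exact Equiv.bijective _

/-- The operators lead with single variables, leading monomials multiply commutatively, and the
result is applied to the vacuum 1. -/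
theorem leads_psi (h : IsNullPair k l) (p : Fin (d + 2) → ℝ) (hkp : mdot k p = -1)
    (x : (ℕ →₀ ℕ) × (ℕ →₀ ℕ) × (ℕ ×ₗ Fin d →₀ ℕ)) :
    lkMonomial p k x.1 x.2.1 (ddfMonomial p k x.2.2) - lcMonomial h (leadExp x) ∈
      fil h (ydeg (leadExp x)) (rdeg (leadExp x) - 1) := by
  have hL : ∀ n : ℕ, Leads h (virasoro p 1 (-((n : ℤ) + 1))) (Finsupp.single (.inl n) 1) :=
    fun n => by
      rw [Leads, ← kdot_right_neg h p]
      exact (shifts_virasoro_sub h p hkp 1 n).mono (by simp [ydeg_single, rdeg_single])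
  have hK : ∀ n : ℕ, Leads h (kdot p k (-((n : ℤ) + 1)))
      (Finsupp.single ((Sum.inr ∘ Sum.inl : ℕ → LCIndex d) n) 1) := fun n => by
    rw [Leads, Function.comp_apply, ← kdot_left_neg h p]
    convert Shifts.zero (h := h) _ _
    exact sub_self _
  have hA : ∀ y : ℕ ×ₗ Fin d, Leads h (ddf p k (ofLex y).2 (-(((ofLex y).1 : ℤ) + 1)))
      (Finsupp.single ((Sum.inr ∘ Sum.inr : ℕ ×ₗ Fin d → LCIndex d) y) 1) := fun y => by
    have := alpha_transv_neg h p (ofLex y).2 (ofLex y).1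
    rw [Prod.mk.eta, toLex_ofLex] at this
    rw [Leads, Function.comp_apply, ← this]
    exact (shifts_ddf_sub h p _ _).mono (by simp [ydeg_single, rdeg_single])
  have h1 := (((Leads.ordMonomial hL x.1).mul (Leads.ordMonomial hK x.2.1)).mul
    (Leads.ordMonomial hA x.2.2)).apply_one
  rw [add_assoc] at h1
  exact h1

/-- A given pair of degrees may belong to infinitely many monomials, since k·α_{-1} has degrees (0,
0). Triangularity needs only that the pairs are well-ordered. -/
theorem psi_basis (h : IsNullPair k l) (p : Fin (d + 2) → ℝ) (hkp : mdot k p = -1) :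
    LinearIndependent ℂ (fun x : (ℕ →₀ ℕ) × (ℕ →₀ ℕ) × (ℕ ×ₗ Fin d →₀ ℕ) =>
      lkMonomial p k x.1 x.2.1 (ddfMonomial p k x.2.2)) ∧
    Submodule.span ℂ (Set.range fun x : (ℕ →₀ ℕ) × (ℕ →₀ ℕ) × (ℕ ×ₗ Fin d →₀ ℕ) =>
      lkMonomial p k x.1 x.2.1 (ddfMonomial p k x.2.2)) = ⊤ := by
  refine (lcBasis h).linearIndependent_and_span_of_triangular
    (fun a => toLex (ydeg a, rdeg a)) _ leadExp_bijective fun x => ?_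
  rw [lcBasis_apply]
  refine Submodule.span_mono ?_ (leads_psi h p hkp x)
  rintro _ ⟨a, ha, rfl⟩
  refine ⟨a, ?_, lcBasis_apply h a⟩
  simp only [Set.mem_ofPred_eq, Prod.Lex.toLex_lt_toLex] at ha ⊢
  omega

end

end CovariantString

/-! ### Generating-function identity behind the DDF commutators -/

/-- If `z P' = a κ P` and `z Q' = b κ Q`, then `z P' Q - a P Q` has no coefficient of degree
`a + b`. -/
theorem PowerSeries.sum_sub_smul_coeff_mul_coeff {A : Type*} [Ring A] [Algebra ℂ A]
    {κ P Q : PowerSeries A} (hκP : Commute κ P) {a b : ℕ} (hab : a + b ≠ 0)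
    (hP : ∀ n : ℕ, (n : ℂ) • coeff n P = (a : ℂ) • coeff n (κ * P))
    (hQ : ∀ n : ℕ, (n : ℂ) • coeff n Q = (b : ℂ) • coeff n (κ * Q)) :
    ∑ x ∈ Finset.HasAntidiagonal.antidiagonal (a + b),
      ((x.1 : ℂ) - a) • (coeff x.1 P * coeff x.2 Q) = 0 := by
  have h1 : ∑ x ∈ Finset.HasAntidiagonal.antidiagonal (a + b), (x.1 : ℂ) • (coeff x.1 P * coeff x.2 Q) =
      (a : ℂ) • coeff (a + b) (κ * P * Q) := by
    rw [coeff_mul, Finset.smul_sum]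
    exact Finset.sum_congr rfl fun x _ => by rw [← smul_mul_assoc, hP, smul_mul_assoc]
  have h2 : ∑ x ∈ Finset.HasAntidiagonal.antidiagonal (a + b), (x.2 : ℂ) • (coeff x.1 P * coeff x.2 Q) =
      (b : ℂ) • coeff (a + b) (κ * P * Q) := by
    rw [hκP.eq, mul_assoc, coeff_mul, Finset.smul_sum]
    exact Finset.sum_congr rfl fun x _ => by rw [← mul_smul_comm, hQ, mul_smul_comm]
  have h3 : ∑ x ∈ Finset.HasAntidiagonal.antidiagonal (a + b), ((x.1 : ℂ) • (coeff x.1 P * coeff x.2 Q) +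
      (x.2 : ℂ) • (coeff x.1 P * coeff x.2 Q)) = ((a : ℂ) + b) • coeff (a + b) (P * Q) := by
    rw [coeff_mul, Finset.smul_sum]
    refine Finset.sum_congr rfl fun x hx => ?_
    rw [← add_smul]
    congr 1
    exact_mod_cast Finset.HasAntidiagonal.mem_antidiagonal.1 hx
  rw [Finset.sum_add_distrib, h1, h2, ← add_smul] at h3
  -- In degree a + b the equation z(PQ)' = (a + b) κPQ loses its factor a + b, so PQ and κPQ have
  -- the same coefficient there.
  have h4 := smul_right_injective A (r := (a : ℂ) + b) (by exact_mod_cast hab) h3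
  simp only [sub_smul, Finset.sum_sub_distrib, h1, h4]
  rw [coeff_mul, Finset.smul_sum, sub_self]

namespace CovariantString

variable {d : ℕ}

/-! ### Commutation relations -/

theorem pderiv_pderiv_comm {σ R : Type*} [CommRing R] (i j : σ) (f : MvPolynomial σ R) :
    MvPolynomial.pderiv i (MvPolynomial.pderiv j f) =
      MvPolynomial.pderiv j (MvPolynomial.pderiv i f) := by
  classical
  have h1 : ⁅MvPolynomial.pderiv (R := R) i, MvPolynomial.pderiv (R := R) j⁆ = 0 := by
    refine MvPolynomial.derivation_ext fun x => ?_
    simp only [Derivation.commutator_apply, MvPolynomial.pderiv_X, Pi.single_apply]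
    split_ifs <;> simp
  have h2 := Derivation.congr_fun h1 f
  rwa [Derivation.commutator_apply, Derivation.zero_apply, sub_eq_zero] at h2

theorem commute_alpha_pos_neg (p : Fin (d + 2) → ℝ) (μ ν : Fin (d + 2)) (m n : ℕ) :
    alpha p μ ((m : ℤ) + 1) * alpha p ν (-((n : ℤ) + 1)) -
      alpha p ν (-((n : ℤ) + 1)) * alpha p μ ((m : ℤ) + 1) =
      if μ = ν ∧ m = n then ((-eta μ * ((m : ℝ) + 1) : ℝ) : ℂ) • (1 : Op d) else 0 := by
  classical
  refine LinearMap.ext fun v => ?_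
  rw [alpha_pos, alpha_neg, LinearMap.sub_apply, Module.End.mul_apply, Module.End.mul_apply,
    LinearMap.smul_apply, LinearMap.smul_apply, LinearMap.mulLeft_apply, LinearMap.mulLeft_apply,
    mul_smul_comm, ← smul_sub]
  rw [show (MvPolynomial.pderiv (R := ℂ) (μ, m)).toLinearMap
      (MvPolynomial.X (ν, n) * v) = _ from Derivation.leibniz _ _ _]
  rw [MvPolynomial.pderiv_X, Pi.single_apply]
  simp only [smul_eq_mul, Prod.mk.injEq, eq_comm (a := ν), eq_comm (a := n)]
  rw [show (MvPolynomial.pderiv (R := ℂ) (μ, m)).toLinearMap v = MvPolynomial.pderiv (μ, m) v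
      from rfl, add_sub_cancel_left]
  split_ifs <;> simp

/-- `[α^μ_a, α^ν_b] = -η_{μν} a δ_{a+b}`. -/
theorem alpha_commutator (p : Fin (d + 2) → ℝ) (μ ν : Fin (d + 2)) (a b : ℤ) :
    alpha p μ a * alpha p ν b - alpha p ν b * alpha p μ a =
      if μ = ν ∧ a + b = 0 then ((-eta μ * a : ℝ) : ℂ) • (1 : Op d) else 0 := by
  classical
  induction a using int_cases with
  | zero =>
    rw [alpha_zero, smul_mul_assoc, mul_smul_comm, one_mul, mul_one, sub_self]
    simp
  | pos m =>
    induction b using int_cases with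
    | zero =>
      rw [alpha_zero, smul_mul_assoc, mul_smul_comm, one_mul, mul_one, sub_self, if_neg]
      omega
    | pos n =>
      rw [if_neg (by omega), sub_eq_zero, alpha_pos, alpha_pos]
      refine LinearMap.ext fun v => ?_
      simp only [Module.End.mul_apply, LinearMap.smul_apply, map_smul]
      rw [smul_comm]
      refine congrArg (_ • ·) (congrArg (_ • ·) ?_)
      exact pderiv_pderiv_comm _ _ v
    | neg n =>
      rw [commute_alpha_pos_neg]
      refine if_congr (by omega) (by push_cast; rfl) rfl
  | neg m =>
    induction b using int_cases with
    | zero =>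
      rw [alpha_zero, smul_mul_assoc, mul_smul_comm, one_mul, mul_one, sub_self, if_neg]
      omega
    | pos n =>
      rw [← neg_sub, commute_alpha_pos_neg]
      split_ifs with h1 h2 h2
      · obtain ⟨rfl, rfl⟩ := h1
        refine LinearMap.ext fun v => ?_
        rw [LinearMap.neg_apply, LinearMap.smul_apply, LinearMap.smul_apply, ← neg_smul]
        congr 1
        push_cast
        ring
      · omega
      · omega
      · exact neg_zero
    | neg n =>
      rw [if_neg (by omega), sub_eq_zero, alpha_neg, alpha_neg]
      refine LinearMap.ext fun v => ?_
      simp only [Module.End.mul_apply, LinearMap.mulLeft_apply]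
      ring

theorem kdot_commutator_alpha (p u : Fin (d + 2) → ℝ) (ν : Fin (d + 2)) (a b : ℤ) :
    kdot p u a * alpha p ν b - alpha p ν b * kdot p u a =
      if a + b = 0 then ((-(a * u ν) : ℝ) : ℂ) • (1 : Op d) else 0 := by
  have h1 : kdot p u a * alpha p ν b - alpha p ν b * kdot p u a = ∑ μ,
      ((eta μ * u μ : ℝ) : ℂ) • (alpha p μ a * alpha p ν b - alpha p ν b * alpha p μ a) := by
    simp only [kdot, Finset.sum_mul, Finset.mul_sum, ← Finset.sum_sub_distrib, smul_sub,
      smul_mul_assoc, mul_smul_comm]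
  rw [h1, Finset.sum_eq_single ν]
  · rw [alpha_commutator]
    split_ifs with h2 h3 h3
    · rw [smul_smul, ← Complex.ofReal_mul]
      congr 2
      linear_combination (-(u ν * a)) * eta_mul_self ν
    · omega
    · omega
    · exact smul_zero _
  · intro μ _ hμ
    rw [alpha_commutator, if_neg (fun e => hμ e.1), smul_zero]
  · simp

section

variable {p k : Fin (d + 2) → ℝ}

theorem commute_kdot_alpha_transv (hkt : ∀ j : Fin d, k (transv j) = 0) (a b : ℤ) (j : Fin d) :
    Commute (kdot p k a) (alpha p (transv j) b) := by
  rw [Commute, SemiconjBy, ← sub_eq_zero, kdot_commutator_alpha, hkt]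
  simp

theorem commute_kdot_kdot (hk : mdot k k = 0) (a b : ℤ) :
    Commute (kdot p k a) (kdot p k b) := by
  have h1 : kdot p k a * kdot p k b - kdot p k b * kdot p k a = ∑ ν,
      ((eta ν * k ν : ℝ) : ℂ) • (kdot p k a * alpha p ν b - alpha p ν b * kdot p k a) := by
    rw [show kdot p k b = ∑ ν, ((eta ν * k ν : ℝ) : ℂ) • alpha p ν b from rfl, Finset.sum_mul,
      Finset.mul_sum, ← Finset.sum_sub_distrib]
    exact Finset.sum_congr rfl fun ν _ => by rw [smul_mul_assoc, mul_smul_comm, smul_sub]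
  rw [Commute, SemiconjBy, ← sub_eq_zero, h1]
  simp only [kdot_commutator_alpha]
  split_ifs
  · simp only [smul_smul, ← Finset.sum_smul, ← Complex.ofReal_mul, ← Complex.ofReal_sum]
    rw [show ∑ ν, eta ν * k ν * -(a * k ν) = -a * mdot k k by
      rw [mdot, Finset.mul_sum]; exact Finset.sum_congr rfl fun ν _ => by ring, hk]
    simp
  · simp

theorem commute_Udag {X : Op d} (hX : ∀ m, Commute X (kdot p k m)) (c : ℝ) (n : ℕ) :
    Commute X (Udag p (c • k) n) := by
  induction n using Nat.strong_induction_on with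
  | _ n ih =>
    cases n with
    | zero => rw [Udag]; exact Commute.one_right _
    | succ n =>
      rw [Udag]
      refine (Commute.sum_right _ _ _ fun x _ => ?_).smul_right _
      rw [kdot_smul]
      exact ((hX _).smul_right _).mul_right (ih _ (by omega))

theorem commute_UdagZ {X : Op d} (hX : ∀ m, Commute X (kdot p k m)) (c : ℝ) (n : ℤ) :
    Commute X (UdagZ p (c • k) n) := by
  rw [UdagZ]
  split_ifs
  · exact Commute.zero_right _
  · exact commute_Udag hX c _

/-- The generating function of the operators `k · α_{-n}`, `n > 0`. -/
def kdotSeries (p k : Fin (d + 2) → ℝ) : PowerSeries (Op d) :=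
  PowerSeries.mk fun n => if n = 0 then 0 else kdot p k (-(n : ℤ))

/-- The recursion for U_n^† is the differential equation z P' = c κ P for P = ∑ U_n^† z^n. -/
theorem smul_Udag (c : ℝ) (n : ℕ) : (n : ℂ) • PowerSeries.coeff n (PowerSeries.mk (Udag p (c • k))) =
    (c : ℂ) • PowerSeries.coeff n (kdotSeries p k * PowerSeries.mk (Udag p (c • k))) := by
  rw [PowerSeries.coeff_mul]
  simp only [PowerSeries.coeff_mk, kdotSeries]
  cases n with
  | zero => simp
  | succ n =>
    rw [Finset.Nat.sum_antidiagonal_succ, Udag, smul_smul]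
    simp only [if_true, zero_mul, zero_add, Nat.succ_ne_zero, if_false]
    rw [Finset.Nat.sum_antidiagonal_eq_sum_range_succ_mk, Finset.sum_range]
    rw [show ((n + 1 : ℕ) : ℂ) * (1 / ((n : ℂ) + 1)) = 1 by
      push_cast; exact mul_one_div_cancel (Nat.cast_add_one_ne_zero n), one_smul, Finset.smul_sum]
    refine Finset.sum_congr rfl fun x _ => ?_
    rw [kdot_smul, smul_mul_assoc]
    push_cast
    rfl

theorem sum_Udag_mul_Udag (hk : mdot k k = 0) {a b : ℕ} (hab : a + b ≠ 0) :
    ∑ x ∈ Finset.HasAntidiagonal.antidiagonal (a + b), ((x.1 : ℂ) - a) •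
      (Udag p ((a : ℝ) • k) x.1 * Udag p ((b : ℝ) • k) x.2) = 0 := by
  have h1 : Commute (kdotSeries p k) (PowerSeries.mk (Udag p ((a : ℝ) • k))) := by
    ext1 n
    rw [PowerSeries.coeff_mul, PowerSeries.coeff_mul, ← Finset.Nat.sum_antidiagonal_swap]
    refine Finset.sum_congr rfl fun x _ => ?_
    simp only [kdotSeries, PowerSeries.coeff_mk, Prod.fst_swap, Prod.snd_swap]
    split_ifs
    · simp
    · exact commute_Udag (commute_kdot_kdot hk _) _ _
  have h2 := PowerSeries.sum_sub_smul_coeff_mul_coeff h1 hab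
    (fun n => by simpa using smul_Udag (p := p) (k := k) (a : ℝ) n)
    (Q := PowerSeries.mk (Udag p ((b : ℝ) • k)))
    (fun n => by simpa using smul_Udag (p := p) (k := k) (b : ℝ) n)
  simpa using h2

/-- The sum over the modes, with `UdagZ` extended by zero. -/
theorem sum_UdagZ_mul_UdagZ (hk : mdot k k = 0) {a b B : ℕ} (hab : a + b ≠ 0) (ha : a ≤ B)
    (hb : b ≤ B) : ∑ r ∈ Finset.Icc (-(B : ℤ)) B, (r : ℂ) •
      (UdagZ p ((a : ℝ) • k) (r + a) * UdagZ p ((b : ℝ) • k) (-r + b)) = 0 := by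
  rw [← sum_Udag_mul_Udag (p := p) hk hab]
  symm
  -- The substitution is r = x.1 - a; modes not reached this way have a factor of negative index,
  -- which is zero.
  refine Finset.sum_of_injOn (fun x => (x.1 : ℤ) - a) ?_ ?_ ?_ ?_
  · intro x hx y hy hxy
    simp only [Finset.mem_coe, Finset.HasAntidiagonal.mem_antidiagonal] at hx hy hxy
    ext <;> omega
  · intro x hx
    simp only [Finset.mem_coe, Finset.HasAntidiagonal.mem_antidiagonal, Finset.mem_Icc] at hx ⊢
    omega
  · intro r hr hr'
    by_cases h1 : r + a < 0
    · rw [UdagZ, if_pos h1, zero_mul, smul_zero]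
    by_cases h2 : -r + b < 0
    · rw [UdagZ, UdagZ, if_pos h2, mul_zero, smul_zero]
    refine absurd ⟨((r + a).toNat, (-r + b).toNat), ?_, ?_⟩ hr'
    · simp only [Finset.mem_coe, Finset.HasAntidiagonal.mem_antidiagonal]
      omega
    · simp only
      omega
  · intro x hx
    simp only [Finset.HasAntidiagonal.mem_antidiagonal] at hx
    rw [UdagZ, UdagZ, if_neg (by omega), if_neg (by omega)]
    rw [show ((x.1 : ℤ) - a + a).toNat = x.1 by omega,
      show (-((x.1 : ℤ) - a) + b).toNat = x.2 by omega]
    push_cast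
    rfl

end

/-! ### The DDF operators on the vectors annihilated by `k · α_m`, `m > 0` -/

/-- The vectors annihilated by all `k · α_m`, `m > 0`. -/
def kdotKernel (p k : Fin (d + 2) → ℝ) : Submodule ℂ (Fock d) :=
  ⨅ n : ℕ, LinearMap.ker (kdot p k ((n : ℤ) + 1))

section

variable {p k : Fin (d + 2) → ℝ}

theorem mem_kdotKernel {v : Fock d} : v ∈ kdotKernel p k ↔ ∀ n : ℕ, kdot p k ((n : ℤ) + 1) v = 0 := by
  simp [kdotKernel]

theorem vac_mem_kdotKernel : vac ∈ kdotKernel p k := mem_kdotKernel.2 fun n => by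
  rw [kdot_pos, vac, Derivation.map_one_eq_zero]

theorem apply_mem_kdotKernel {X : Op d} (hX : ∀ m, Commute (kdot p k m) X) {v : Fock d}
    (hv : v ∈ kdotKernel p k) : X v ∈ kdotKernel p k := mem_kdotKernel.2 fun n => by
  rw [← Module.End.mul_apply, hX, Module.End.mul_apply, mem_kdotKernel.1 hv, map_zero]

theorem UZ_apply_of_ne_zero (c : ℝ) {r : ℤ} (hr : r ≠ 0) {v : Fock d} (hv : v ∈ kdotKernel p k) :
    UZ p (c • k) r v = 0 := by
  rw [UZ]
  split_ifs with h
  · rfl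
  obtain ⟨n, hn⟩ : ∃ n, r.toNat = n + 1 := ⟨r.toNat - 1, by omega⟩
  rw [hn, U, LinearMap.smul_apply, LinearMap.sum_apply, Finset.sum_eq_zero, smul_zero]
  intro x _
  rw [Module.End.mul_apply, kdot_smul, LinearMap.smul_apply, mem_kdotKernel.1 hv, smul_zero,
    map_zero]

/-- All U_q with q ≠ 0 kill v, so only the creation part of the q = 0 term survives. -/
theorem V_apply (c : ℝ) (n : ℤ) {v : Fock d} (hv : v ∈ kdotKernel p k) :
    V p (c • k) n v = UdagZ p ((-c) • k) (-n) v := by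
  have h1 : V p (c • k) n v = ∑ᶠ q : ℤ, (UdagZ p (-(c • k)) (q - n) * UZ p (c • k) q) v := rfl
  rw [h1, finsum_eq_single _ 0]
  · rw [UZ_zero, mul_one, zero_sub, neg_smul]
  · intro q hq
    rw [Module.End.mul_apply, UZ_apply_of_ne_zero c hq hv, map_zero]

theorem UdagZ_of_neg (q : Fin (d + 2) → ℝ) {r : ℤ} (hr : r < 0) : UdagZ p q r = 0 := if_pos hr

/-- The pairing of r with -r matches the summands of `Vbar`; the term r = 0 is the one with p^μ. -/
theorem sum_Icc_neg {M : Type*} [AddCommMonoid M] (f : ℤ → M) (B : ℕ) :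
    ∑ r ∈ Finset.Icc (-(B : ℤ)) B, f r =
      ∑ q ∈ Finset.range B, (f (-((q : ℤ) + 1)) + f ((q : ℤ) + 1)) + f 0 := by
  induction B with
  | zero => simp
  | succ B ih =>
    have h1 : Finset.Icc (-((B + 1 : ℕ) : ℤ)) ((B + 1 : ℕ) : ℤ) =
        insert (-((B : ℤ) + 1)) (insert ((B : ℤ) + 1) (Finset.Icc (-(B : ℤ)) B)) := by
      ext r
      simp only [Finset.mem_insert, Finset.mem_Icc]
      push_cast
      omega
    rw [h1, Finset.sum_insert, Finset.sum_insert, ih, Finset.sum_range_succ]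
    · abel
    · simp
    · simp only [Finset.mem_insert, Finset.mem_Icc]
      omega

/-- On the vectors annihilated by `k · α_m`, `m > 0`, the DDF operators are
`∑_r U_{r+n}(n k)^† α^j_r`. -/
theorem ddf_apply (hkt : ∀ j : Fin d, k (transv j) = 0) (j : Fin d) (n : ℕ) {B : ℕ} {v : Fock d}
    (hv : v ∈ kdotKernel p k) (hvB : v ∈ lvl d B) (hnB : n ≤ B) :
    ddf p k j (-(n : ℤ)) v = ∑ r ∈ Finset.Icc (-(B : ℤ)) B,
      UdagZ p ((n : ℝ) • k) (r + n) (alpha p (transv j) r v) := by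
  have hc : -(((-(n : ℤ) : ℤ) : ℝ)) = (n : ℝ) := by push_cast; ring
  have h1 : Vbar p ((((-(n : ℤ) : ℤ) : ℝ)) • k) (transv j) (-(n : ℤ)) v = ∑ᶠ q : ℕ,
      (UdagZ p ((n : ℝ) • k) (-((q : ℤ) + 1) + n) (alpha p (transv j) (-((q : ℤ) + 1)) v) +
        UdagZ p ((n : ℝ) • k) (((q : ℤ) + 1) + n) (alpha p (transv j) ((q : ℤ) + 1) v)) := by
    refine finsum_congr fun q => ?_
    rw [LinearMap.add_apply, Module.End.mul_apply, Module.End.mul_apply, V_apply _ _ hv,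
      V_apply _ _ (apply_mem_kdotKernel (fun m => commute_kdot_alpha_transv hkt m _ j) hv), hc]
    congr 1
    · rw [← Module.End.mul_apply, ← Module.End.mul_apply]
      rw [(commute_UdagZ (fun m => (commute_kdot_alpha_transv hkt m _ j).symm) _ _).eq]
      congr 3
      ring
    · congr 2
      ring
  rw [ddf, Vvec, LinearMap.add_apply, LinearMap.smul_apply, V_apply _ _ hv, h1, hc, sum_Icc_neg,
    alpha_zero, LinearMap.smul_apply, map_smul, neg_neg, zero_add, Module.End.one_apply]
  congr 1
  -- Beyond B the first term vanishes by its negative index, as n ≤ B, and the second because v has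
  -- level at most B.
  refine finsum_eq_sum_of_support_subset _ fun q hq => ?_
  by_contra hqB
  simp only [Finset.coe_range, Set.mem_Iio, not_lt] at hqB
  refine hq ?_
  dsimp only
  rw [UdagZ_of_neg _ (by omega), LinearMap.zero_apply, zero_add,
    (alpha_lowers p _ _).apply_eq_zero hvB (by omega), map_zero]

theorem ddf_mem_kdotKernel (hk : mdot k k = 0) (hkt : ∀ j : Fin d, k (transv j) = 0) (j : Fin d)
    (n : ℕ) {v : Fock d} (hv : v ∈ kdotKernel p k) : ddf p k j (-(n : ℤ)) v ∈ kdotKernel p k := by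
  obtain ⟨N, hN⟩ := exists_lvl v
  rw [ddf_apply hkt j n (B := N.toNat + n) hv (lvl_mono (by push_cast; omega) hN) (by omega)]
  refine Submodule.sum_mem _ fun r _ => ?_
  exact apply_mem_kdotKernel (fun m => commute_UdagZ (commute_kdot_kdot hk m) _ _)
    (apply_mem_kdotKernel (fun m => commute_kdot_alpha_transv hkt m _ j) hv)

theorem ddf_lowers (j : Fin d) (n : ℤ) : Lowers (ddf p k j n) n :=
  Lowers.add (Lowers.locSum _ fun q => Lowers.add
    (((alpha_lowers p _ _).mul (V_lowers p _ _)).cast (by ring))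
    (((V_lowers p _ _).mul (alpha_lowers p _ _)).cast (by ring))) ((V_lowers p _ n).smul _)

/-- The product of two DDF operators on the vectors annihilated by `k · α_m`, `m > 0`. -/
theorem ddf_ddf_apply (hk : mdot k k = 0) (hkt : ∀ j : Fin d, k (transv j) = 0) (i j : Fin d)
    (m n : ℕ) {B : ℕ} {v : Fock d} (hv : v ∈ kdotKernel p k) {N : ℕ} (hvN : v ∈ lvl d N)
    (hB : N + n + m ≤ B) :
    ddf p k i (-(m : ℤ)) (ddf p k j (-(n : ℤ)) v) =
      ∑ r ∈ Finset.Icc (-(B : ℤ)) B, ∑ s ∈ Finset.Icc (-(B : ℤ)) B,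
        (UdagZ p ((m : ℝ) • k) (r + m) * UdagZ p ((n : ℝ) • k) (s + n))
          ((alpha p (transv i) r * alpha p (transv j) s) v) := by
  have h1 := ddf_lowers (p := p) (k := k) j (-(n : ℤ)) N v hvN
  rw [ddf_apply hkt i m (B := B) (ddf_mem_kdotKernel hk hkt j n hv)
    (lvl_mono (by omega) h1) (by omega),
    ddf_apply hkt j n (B := B) hv (lvl_mono (by omega) hvN) (by omega)]
  refine Finset.sum_congr rfl fun r _ => ?_
  rw [map_sum, map_sum]
  refine Finset.sum_congr rfl fun s _ => ?_
  have h2 := (commute_UdagZ (p := p) (k := k)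
    (fun m => (commute_kdot_alpha_transv hkt m r i).symm) (n : ℝ) (s + n)).eq
  rw [Module.End.mul_apply, Module.End.mul_apply]
  congr 1
  rw [← Module.End.mul_apply, h2, Module.End.mul_apply]

/-- The exponentials commute with each other, so only the oscillators contract: [α^i_r, α^j_s] = r
δ_{ij} δ_{r+s,0}. What remains is the sum of r U_{r+m}(mk)^† U_{-r+n}(nk)^†, which vanishes by
`sum_UdagZ_mul_UdagZ`. -/
theorem ddf_comm (hk : mdot k k = 0) (hkt : ∀ j : Fin d, k (transv j) = 0) (i j : Fin d)
    (m n : ℕ) (hmn : m + n ≠ 0) {v : Fock d} (hv : v ∈ kdotKernel p k) :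
    ddf p k i (-(m : ℤ)) (ddf p k j (-(n : ℤ)) v) =
      ddf p k j (-(n : ℤ)) (ddf p k i (-(m : ℤ)) v) := by
  obtain ⟨N, hN⟩ := exists_lvl v
  have hN' : v ∈ lvl d (N.toNat : ℤ) := lvl_mono (by omega) hN
  set B := N.toNat + n + m with hB
  rw [ddf_ddf_apply hk hkt i j m n hv hN' hB.ge, ddf_ddf_apply hk hkt j i n m hv hN'
    (B := B) (by omega), Finset.sum_comm (s := Finset.Icc (-(B : ℤ)) B), ← sub_eq_zero,
    ← Finset.sum_sub_distrib]
  -- For fixed s, the contraction leaves only r = -s.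
  have h1 : ∀ s ∈ Finset.Icc (-(B : ℤ)) B, ∑ r ∈ Finset.Icc (-(B : ℤ)) B,
        (UdagZ p ((m : ℝ) • k) (r + m) * UdagZ p ((n : ℝ) • k) (s + n))
          ((alpha p (transv i) r * alpha p (transv j) s) v) -
      ∑ r ∈ Finset.Icc (-(B : ℤ)) B,
        (UdagZ p ((n : ℝ) • k) (s + n) * UdagZ p ((m : ℝ) • k) (r + m))
          ((alpha p (transv j) s * alpha p (transv i) r) v) =
      if i = j then ((-s : ℤ) : ℂ) •
        (UdagZ p ((m : ℝ) • k) (-s + m) * UdagZ p ((n : ℝ) • k) (s + n)) v else 0 := by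
    intro s hs
    rw [← Finset.sum_sub_distrib, Finset.sum_eq_single (-s)]
    · rw [(commute_UdagZ (p := p) (k := k) (fun r => (commute_UdagZ (fun q =>
          commute_kdot_kdot hk r q) (n : ℝ) (s + n)).symm) (m : ℝ) (-s + m)).eq, ← map_sub,
        ← LinearMap.sub_apply, alpha_commutator, eta_transv]
      by_cases hij : i = j
      · rw [if_pos ⟨by rw [hij], by ring⟩, if_pos hij, LinearMap.smul_apply, map_smul]
        simp
      · rw [if_neg fun e => hij (transv_injective e.1), if_neg hij, LinearMap.zero_apply, map_zero]
    · intro r _ hr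
      rw [(commute_UdagZ (p := p) (k := k) (fun q => (commute_UdagZ (fun q' =>
          commute_kdot_kdot hk q q') (n : ℝ) (s + n)).symm) (m : ℝ) (r + m)).eq, ← map_sub,
        ← LinearMap.sub_apply, alpha_commutator, if_neg fun e => hr (by omega),
        LinearMap.zero_apply, map_zero]
    · intro hs'
      simp only [Finset.mem_Icc] at hs hs'
      omega
  rw [Finset.sum_congr rfl h1]
  split_ifs
  · have h2 := sum_UdagZ_mul_UdagZ (p := p) hk (B := B) hmn (by omega) (by omega)
    have h3 := LinearMap.congr_fun h2 v
    rw [LinearMap.sum_apply, LinearMap.zero_apply] at h3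
    rw [← h3]
    refine Finset.sum_nbij' (fun s => -s) (fun s => -s) ?_ ?_ (by simp) (by simp) ?_
    · simp only [Finset.mem_Icc]; omega
    · simp only [Finset.mem_Icc]; omega
    · intro s _
      rw [LinearMap.smul_apply, neg_neg]
  · exact Finset.sum_const_zero

end

/-! ### Ordering of products -/

section

variable {ι : Type} {T : ι → Op d} {W : Submodule ℂ (Fock d)}

theorem prod_apply_mem (hW : ∀ x, ∀ v ∈ W, T x v ∈ W) {v : Fock d} (hv : v ∈ W) (L : List ι) :
    (L.map T).prod v ∈ W := by
  induction L with
  | nil => exact hv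
  | cons x L ih => exact hW x _ ih

/-- Commutation is available only on the stable subspace `W`, hence the statement about vectors and
not about operators. -/
theorem prod_apply_perm (hW : ∀ x, ∀ v ∈ W, T x v ∈ W)
    (hT : ∀ x y, ∀ v ∈ W, T x (T y v) = T y (T x v)) {v : Fock d} (hv : v ∈ W) {L L' : List ι}
    (hL : L.Perm L') : (L.map T).prod v = (L'.map T).prod v := by
  induction hL with
  | nil => rfl
  | cons x _ ih =>
    simp only [List.map_cons, List.prod_cons, Module.End.mul_apply, ih]
  | swap x y L =>
    simp only [List.map_cons, List.prod_cons, Module.End.mul_apply]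
    exact hT _ _ _ (prod_apply_mem hW hv L)
  | trans _ _ ih ih' => exact ih.trans ih'

theorem exists_perm_ordMonomial [LinearOrder ι] (T : ι → Op d) (L : List ι) :
    ∃ e : ι →₀ ℕ, ∃ L', L.Perm L' ∧ ordMonomial T e = (L'.map T).prod := by
  -- The exponents are the multiplicities in `L`.
  set e : ι →₀ ℕ := Multiset.toFinsupp (L : Multiset ι)
  have h1 : ∀ S : List ι, (S.map fun i => T i ^ e i).prod =
      ((S.flatMap fun i => List.replicate (e i) i).map T).prod := by
    intro S
    induction S with
    | nil => rfl
    | cons i S ih => simp [ih]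
  have h2 : ∀ (S : List ι) (i : ι), S.Nodup →
      (S.flatMap fun i => List.replicate (e i) i).count i = if i ∈ S then e i else 0 := by
    intro S i hS
    induction S with
    | nil => simp
    | cons x S ih =>
      rw [List.nodup_cons] at hS
      rw [List.flatMap_cons, List.count_append, ih hS.2, List.count_replicate]
      by_cases hx : x = i
      · subst hx
        simp [hS.1]
      · simp [hx, Ne.symm hx]
  refine ⟨e, _, List.perm_iff_count.2 fun i => ?_, h1 _⟩
  have h3 : e i = L.count i := by simp [e]
  rw [h2 _ i (Finset.sort_nodup _ _)]
  split_ifs with hi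
  · exact h3.symm
  · rw [Finset.mem_sort, Finsupp.notMem_support_iff] at hi
    rw [← h3, hi]

end

/-- Each word of creating DDF operators can be sorted when it acts on the vacuum, because all
intermediate vectors stay in `kdotKernel`. -/
theorem ddfStates_le_span {p k : Fin (d + 2) → ℝ} (hk : mdot k k = 0)
    (hkt : ∀ j : Fin d, k (transv j) = 0) :
    ddfStates p k ≤ Submodule.span ℂ (Set.range (ddfMonomial p k)) := by
  refine Submodule.span_le.2 ?_
  rintro _ ⟨w, hw, rfl⟩
  set T : ℕ ×ₗ Fin d → Op d := fun x => ddf p k (ofLex x).2 (-(((ofLex x).1 : ℤ) + 1))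
  obtain ⟨e, L', hL, he⟩ := exists_perm_ordMonomial T
    (w.map fun x => toLex ((-x.2 - 1).toNat, x.1))
  refine Submodule.subset_span ⟨e, ?_⟩
  have h1 : (w.map fun x => ddf p k x.1 x.2) =
      (w.map fun x => toLex ((-x.2 - 1).toNat, x.1)).map T := by
    rw [List.map_map]
    refine List.map_congr_left fun x hx => ?_
    have := hw x hx
    simp only [T, Function.comp_apply, ofLex_toLex]
    congr 1
    omega
  have h2 : ∀ x, T x = ddf p k (ofLex x).2 (-(((ofLex x).1 + 1 : ℕ) : ℤ)) := fun x => by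
    simp [T]
  rw [ddfMonomial, he, h1]
  refine (prod_apply_perm (W := kdotKernel p k) ?_ ?_ vac_mem_kdotKernel hL).symm
  · intro x v hv
    rw [h2]
    exact ddf_mem_kdotKernel hk hkt _ _ hv
  · intro x y v hv
    rw [h2, h2]
    exact ddf_comm hk hkt _ _ _ _ (by omega) hv

theorem ddfMonomial_mem_ddfStates (p k : Fin (d + 2) → ℝ) (β : ℕ ×ₗ Fin d →₀ ℕ) :
    ddfMonomial p k β ∈ ddfStates p k := by
  refine Submodule.subset_span ⟨β.support.sort.flatMap fun x =>
    List.replicate (β x) ((ofLex x).2, -(((ofLex x).1 : ℤ) + 1)), ?_, ?_⟩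
  · intro x hx
    obtain ⟨y, _, hy⟩ := List.mem_flatMap.1 hx
    rw [List.eq_of_mem_replicate hy]
    simp only
    omega
  · rw [ddfMonomial, ordMonomial]
    congr 1
    generalize β.support.sort = S
    induction S with
    | nil => rfl
    | cons i S ih =>
      rw [List.map_cons, List.prod_cons, ih, List.flatMap_cons, List.map_append, List.prod_append,
        List.map_replicate, List.prod_replicate]

end CovariantString

end

/-! ### The three statements -/

open CovariantString in
theorem mainTheorem5 (d : ℕ) (p k : Fin (d + 2) → ℝ)
    (hk : mdot k k = 0) (hkt : ∀ j : Fin d, k (transv j) = 0) (hkp : mdot k p = -1) :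
    (∀ (ι : Type*) (f : ι → Fock d), (∀ i, f i ∈ ddfStates p k) → LinearIndependent ℂ f →
      LinearIndependent ℂ fun x : (ℕ →₀ ℕ) × (ℕ →₀ ℕ) × ι =>
        lkMonomial p k x.1 x.2.1 (f x.2.2)) ∧
    Submodule.span ℂ {Ψ : Fock d | ∃ lam mu : ℕ →₀ ℕ, ∃ f ∈ ddfStates p k,
      Ψ = lkMonomial p k lam mu f} = ⊤ ∧
    LinearIndependent ℂ (fun x : (ℕ →₀ ℕ) × (ℕ →₀ ℕ) × (ℕ ×ₗ Fin d →₀ ℕ) =>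
      lkMonomial p k x.1 x.2.1 (ddfMonomial p k x.2.2)) ∧
    Submodule.span ℂ (Set.range fun x : (ℕ →₀ ℕ) × (ℕ →₀ ℕ) × (ℕ ×ₗ Fin d →₀ ℕ) =>
      lkMonomial p k x.1 x.2.1 (ddfMonomial p k x.2.2)) = ⊤ := by
  have h0 : k ≠ 0 := by
    rintro rfl
    simp [mdot] at hkp
  obtain ⟨l, h⟩ := exists_isNullPair hk hkt h0
  obtain ⟨hli, hspan⟩ := psi_basis h p hkp
  refine ⟨fun ι f hf hfi => ?_, ?_, hli, hspan⟩
  · have h1 : LinearIndependent ℂ fun z : ((ℕ →₀ ℕ) × (ℕ →₀ ℕ)) × (ℕ ×ₗ Fin d →₀ ℕ) =>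
        lkMonomial p k z.1.1 z.1.2 (ddfMonomial p k z.2) :=
      hli.comp (Equiv.prodAssoc _ _ _) (Equiv.injective _)
    -- Each `f i` is a combination of ordered DDF monomials, so independence transfers from
    -- statement 3.
    have h2 := LinearIndependent.of_mem_span
      (T := fun x : (ℕ →₀ ℕ) × (ℕ →₀ ℕ) => lkMonomial p k x.1 x.2) h1 hfi
      fun i => ddfStates_le_span hk hkt (hf i)
    exact h2.comp (Equiv.prodAssoc _ _ _).symm (Equiv.injective _)
  · rw [eq_top_iff, ← hspan]
    refine Submodule.span_mono ?_
    rintro _ ⟨x, rfl⟩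
    exact ⟨x.1, x.2.1, _, ddfMonomial_mem_ddfStates p k _, rfl⟩
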